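/- An affine plane is a set of points with a family of sets of points, called lines, such that two distinct points lie on exactly one line; for every line $\ell$ and every point $A\notin\ell$ there is exactly one line through $A$ disjoint from $\ell$; and there are three non-collinear points. Two lines are parallel if they are equal or disjoint. Desargues' axiom concerns three distinct lines $k,l,m$ and points $A,A'\in k$, $B,B'\in l$, $C,C'\in m$; it says that $AB\parallel A'B'$ and $BC\parallel B'C'$ imply $AC\parallel A'C'$. In the parallel form, $k,l,m$ are pairwise parallel; in the concurrent form, $k,l,m$ pass through a common point $O$ and all six points differ from $O$. A plane is Desarguesian if both forms hold. A plane is ordered if it carries a relation $[A,B,C]$ ("$B$ is between $A$ and $C$") such that, for mutually distinct points of each line: (1) $[A,B,C]$ implies $[C,B,A]$; (2) exactly one of $[A,B,C]$, $[B,C,A]$, $[C,A,B]$ holds; (3) $[A,B,C]$ and $[B,C,D]$ imply $[A,B,D]$ and $[A,C,D]$; (4) $[A,B,C]$ and $[C,B,D]$ imply $[D,A,B]$ or $[A,D,B]$; and every parallel projection of a line onto a line preserves betweenness, i.e. preserves or reverses the order. A plane is Pappian if, for all distinct lines $l,m$, distinct points $a_1,a_2,a_3\in l\setminus m$ and distinct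 $b_1,b_2,b_3\in m\setminus l$, the three intersections $a_ib_j\cap a_jb_i$ ($i<j$) are collinear, where parallel lines $a_ib_j\parallel a_jb_i$ are understood to meet at infinity. That is: if all three intersections exist, they lie on a line; if two exist and the lines of the third pair are parallel, then some line through the two intersections is parallel to these lines; if the lines of two pairs are parallel, so are those of the third. **Theorem.** (i) Every finite Desarguesian affine plane is Pappian. (ii) Every finite ordered affine plane that satisfies at least the parallel form of Desargues' axiom is Pappian. In particular, every finite ordered Desarguesian affine plane is Pappian, wherever its points lie (for example in $\mathbb R^2$). -/

import Mathlib

/-- An affine plane with point set `P`: a family of sets of points, the lines, such that two distinct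
points lie on exactly one line, the parallel axiom of Playfair holds, and there are three
non-collinear points. -/
structure AffinePlane (P : Type*) where
  lines : Set (Set P)
  line_through : ∀ A B : P, A ≠ B → ∃! l : Set P, l ∈ lines ∧ A ∈ l ∧ B ∈ l
  playfair : ∀ (A : P) (l : Set P), l ∈ lines → A ∉ l →
    ∃! l' : Set P, l' ∈ lines ∧ A ∈ l' ∧ Disjoint l l'
  noncollinear : ∃ A B C : P, A ≠ B ∧ B ≠ C ∧ A ≠ C ∧
    ∀ l : Set P, l ∈ lines → ¬ (A ∈ l ∧ B ∈ l ∧ C ∈ l)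

namespace AffinePlane

variable {P : Type*} (π : AffinePlane P)

/-- `π.Join A B l`: the line `l` of `π` passes through `A` and `B`. For `A ≠ B` this says that
`l` is the line `AB`. -/
def Join (A B : P) (l : Set P) : Prop :=
  l ∈ π.lines ∧ A ∈ l ∧ B ∈ l

/-- Two lines are parallel when they are equal or have no common point. -/
def Parallel (l m : Set P) : Prop :=
  l = m ∨ Disjoint l m

/-- The conclusion of the axioms of Desargues for two triangles `ABC` and `A'B'C'`: if `AB` is
parallel to `A'B'` and `BC` is parallel to `B'C'`, then `AC` is parallel to `A'C'`. -/
def DesarguesFor (A B C A' B' C' : P) : Prop :=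
  ∀ ab bc ac ab' bc' ac' : Set P,
    π.Join A B ab → π.Join B C bc → π.Join A C ac →
    π.Join A' B' ab' → π.Join B' C' bc' → π.Join A' C' ac' →
    Parallel ab ab' → Parallel bc bc' → Parallel ac ac'

/-- The axiom of Desargues for triangles with corresponding vertices on three distinct
parallel lines. -/
def ParallelDesargues : Prop :=
  ∀ k l m : Set P, k ∈ π.lines → l ∈ π.lines → m ∈ π.lines →
    k ≠ l → l ≠ m → k ≠ m → Parallel k l → Parallel l m → Parallel k m →
    ∀ A B C A' B' C' : P, A ∈ k → A' ∈ k → B ∈ l → B' ∈ l → C ∈ m → C' ∈ m →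
      π.DesarguesFor A B C A' B' C'

/-- The axiom of Desargues for triangles with corresponding vertices on three distinct lines
through a common point `O`, no vertex being equal to `O`. -/
def ConcurrentDesargues : Prop :=
  ∀ k l m : Set P, k ∈ π.lines → l ∈ π.lines → m ∈ π.lines →
    k ≠ l → l ≠ m → k ≠ m → ∀ O : P, O ∈ k → O ∈ l → O ∈ m →
    ∀ A B C A' B' C' : P, A ∈ k → A' ∈ k → B ∈ l → B' ∈ l → C ∈ m → C' ∈ m →
      A ≠ O → A' ≠ O → B ≠ O → B' ≠ O → C ≠ O → C' ≠ O →
      π.DesarguesFor A B C A' B' C'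

/-- A Desarguesian affine plane: both affine forms of the axiom of Desargues hold. -/
def IsDesarguesian : Prop :=
  π.ParallelDesargues ∧ π.ConcurrentDesargues

/-- `btw A B C` (read: `B` lies between `A` and `C`) makes the set `l` an ordered line. The axioms
concern mutually distinct points; the value of `btw` on other triples is irrelevant. -/
structure IsOrderedLine (btw : P → P → P → Prop) (l : Set P) : Prop where
  symm : ∀ A ∈ l, ∀ B ∈ l, ∀ C ∈ l, A ≠ B → B ≠ C → A ≠ C → btw A B C → btw C B A
  exactly_one : ∀ A ∈ l, ∀ B ∈ l, ∀ C ∈ l, A ≠ B → B ≠ C → A ≠ C →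
    (btw A B C ∧ ¬ btw B C A ∧ ¬ btw C A B) ∨
    (¬ btw A B C ∧ btw B C A ∧ ¬ btw C A B) ∨
    (¬ btw A B C ∧ ¬ btw B C A ∧ btw C A B)
  outer : ∀ A ∈ l, ∀ B ∈ l, ∀ C ∈ l, ∀ D ∈ l,
    A ≠ B → A ≠ C → A ≠ D → B ≠ C → B ≠ D → C ≠ D →
    btw A B C → btw B C D → btw A B D ∧ btw A C D
  same_side : ∀ A ∈ l, ∀ B ∈ l, ∀ C ∈ l, ∀ D ∈ l,
    A ≠ B → A ≠ C → A ≠ D → B ≠ C → B ≠ D → C ≠ D →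
    btw A B C → btw C B D → btw D A B ∨ btw A D B

/-- `X'` is the image of `X` under the parallel projection onto the line `l'` in the direction
of the line `d`. -/
def ProjectsTo (d l' : Set P) (X X' : P) : Prop :=
  X' ∈ l' ∧ ∃ e : Set P, π.Join X X' e ∧ Parallel d e

/-- The betweenness relation `btw` makes `π` an ordered plane: every line is an ordered line, and
every parallel projection of a line onto a line preserves betweenness. (A betweenness relation
determines the linear order of a line up to reversal, so this says that the projection preserves or
reverses the order.) -/
structure IsOrderedBy (btw : P → P → P → Prop) : Prop where
  ordered_line : ∀ l : Set P, l ∈ π.lines → IsOrderedLine btw l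
  projection : ∀ l l' d : Set P, l ∈ π.lines → l' ∈ π.lines → d ∈ π.lines →
    ¬ Parallel d l → ¬ Parallel d l' →
    ∀ A B C A' B' C' : P, A ∈ l → B ∈ l → C ∈ l → A ≠ B → B ≠ C → A ≠ C →
      π.ProjectsTo d l' A A' → π.ProjectsTo d l' B B' → π.ProjectsTo d l' C C' →
      btw A B C → btw A' B' C'

/-- A hexagon of Pappus: `a₁, a₂, a₃` are distinct points on a line `l`, `b₁, b₂, b₃` are distinct
points on another line `m`, and none of the six points is common to both lines; `cᵢⱼ` is the line
through `aᵢ` and `bⱼ`. -/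
structure IsPappusHexagon (l m : Set P) (a₁ a₂ a₃ b₁ b₂ b₃ : P)
    (c₁₂ c₂₁ c₂₃ c₃₂ c₁₃ c₃₁ : Set P) : Prop where
  line_l : l ∈ π.lines
  line_m : m ∈ π.lines
  a_on : a₁ ∈ l ∧ a₂ ∈ l ∧ a₃ ∈ l
  b_on : b₁ ∈ m ∧ b₂ ∈ m ∧ b₃ ∈ m
  a_off : a₁ ∉ m ∧ a₂ ∉ m ∧ a₃ ∉ m
  b_off : b₁ ∉ l ∧ b₂ ∉ l ∧ b₃ ∉ l
  a_distinct : a₁ ≠ a₂ ∧ a₂ ≠ a₃ ∧ a₁ ≠ a₃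
  b_distinct : b₁ ≠ b₂ ∧ b₂ ≠ b₃ ∧ b₁ ≠ b₃
  join₁₂ : π.Join a₁ b₂ c₁₂
  join₂₁ : π.Join a₂ b₁ c₂₁
  join₂₃ : π.Join a₂ b₃ c₂₃
  join₃₂ : π.Join a₃ b₂ c₃₂
  join₁₃ : π.Join a₁ b₃ c₁₃
  join₃₁ : π.Join a₃ b₁ c₃₁

/-- A Pappian affine plane: for every hexagon of Pappus the three intersections of opposite sides are
collinear, where the common point of two parallel lines is their point at infinity. The three
clauses treat the cases of no, one and at least two pairs of parallel opposite sides. (The other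
distributions of parallel pairs are covered by permuting the indices.) -/
def IsPappian : Prop :=
  ∀ (l m : Set P) (a₁ a₂ a₃ b₁ b₂ b₃ : P) (c₁₂ c₂₁ c₂₃ c₃₂ c₁₃ c₃₁ : Set P),
    π.IsPappusHexagon l m a₁ a₂ a₃ b₁ b₂ b₃ c₁₂ c₂₁ c₂₃ c₃₂ c₁₃ c₃₁ →
    (∀ X Y Z : P, X ∈ c₁₂ ∩ c₂₁ → Y ∈ c₂₃ ∩ c₃₂ → Z ∈ c₁₃ ∩ c₃₁ →
      ∃ n ∈ π.lines, X ∈ n ∧ Y ∈ n ∧ Z ∈ n) ∧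
    (∀ X Y : P, X ∈ c₁₂ ∩ c₂₁ → Y ∈ c₂₃ ∩ c₃₂ → Parallel c₁₃ c₃₁ →
      ∃ n ∈ π.lines, X ∈ n ∧ Y ∈ n ∧ Parallel n c₁₃) ∧
    (Parallel c₁₂ c₂₁ → Parallel c₂₃ c₃₂ → Parallel c₁₃ c₃₁)

end AffinePlane

/-! Part (i) combines the coordinatization of a Desarguesian plane with Wedderburn's little theorem.
A Pappus hexagon supplies a line with three points and a point off it, so every line has at least
three points (`isParallelism`), and the plane can be treated through its directions alone. Both
forms of Desargues' axiom say that a pencil of lines (parallel or concurrent) admits dilations that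
move a point to any prescribed point on its line of the pencil
(`IsDesarguesPencil.exists_dilation`). The parallel pencils give translations, which turn the points
into an abelian group. The concurrent pencils give homotheties, which are endomorphisms of this
group. The endomorphisms that preserve every line through 0 form a ring without zero divisors that
acts transitively on the nonzero points of each such line. For a finite plane this ring is a finite
domain, hence a field `K`, the plane is `K²` (`exists_coordinates`), and Pappus' theorem becomes a
polynomial identity.

Part (ii) holds because a line of a finite ordered plane has at most two points
(`IsOrderedBy.not_three`), so there are no hexagons. A finite ordered line has an extreme point, but
two projections carry an inner point to it, and projections preserve being between. -/

/-! ### Directions, dilations and Desarguesian pencils -/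

/-- A family of equivalence relations `E d`, indexed by the directions `d`, on the points of a plane:
`E d X Y` says that `X` and `Y` lie on a common line of direction `d`. Every line has at least
three points. -/
structure IsParallelism {P D : Type*} (E : D → P → P → Prop) : Prop where
  refl : ∀ d X, E d X X
  symm : ∀ {d X Y}, E d X Y → E d Y X
  trans : ∀ {d X Y Z}, E d X Y → E d Y Z → E d X Z
  exists_dir : ∀ X Y, ∃ d, E d X Y
  eq_of_dir_ne : ∀ {d e X Y}, d ≠ e → E d X Y → E e X Y → X = Y
  meet : ∀ {d e}, d ≠ e → ∀ X Y, ∃ Z, E d X Z ∧ E e Y Z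
  exists_ne_ne : ∀ d A B, ∃ C, E d A C ∧ C ≠ A ∧ C ≠ B
  exists_dir_ne_ne : ∀ d e : D, ∃ c, c ≠ d ∧ c ≠ e

namespace IsParallelism

variable {P D : Type*} {E : D → P → P → Prop}

theorem dir_unique (h : IsParallelism E) {d e : D} {X Y : P} (hXY : X ≠ Y) (h1 : E d X Y)
    (h2 : E e X Y) : d = e := by
  by_contra hde
  exact hXY (h.eq_of_dir_ne hde h1 h2)

theorem exists_ne (h : IsParallelism E) (d : D) (A : P) : ∃ C, E d A C ∧ C ≠ A := by
  obtain ⟨C, h1, h2, -⟩ := h.exists_ne_ne d A A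
  exact ⟨C, h1, h2⟩

theorem exists_off (h : IsParallelism E) (d : D) (A : P) : ∃ C, ¬ E d A C := by
  obtain ⟨e, he, -⟩ := h.exists_dir_ne_ne d d
  obtain ⟨C, h1, h2⟩ := h.exists_ne e A
  exact ⟨C, fun h3 => h2 (h.eq_of_dir_ne he h1 h3).symm⟩

/-- A dilation, possibly constant: a map that preserves the direction of every line. -/
def _root_.IsDilation (E : D → P → P → Prop) (f : P → P) : Prop :=
  ∀ d X Y, E d X Y → E d (f X) (f Y)

/-- Two dilations that agree at two distinct points are equal. -/
theorem dilation_ext (h : IsParallelism E) {f g : P → P} (hf : IsDilation E f)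
    (hg : IsDilation E g) {A B : P} (hAB : A ≠ B) (hA : f A = g A) (hB : f B = g B) : f = g := by
  -- Off the line `AB`, the image of `X` is the intersection of two lines of known directions
  -- through the images of `A` and `B`. A point on `AB` is reached from `A` and an auxiliary point
  -- off `AB`.
  have key : ∀ A B X d, A ≠ B → f A = g A → f B = g B → E d A B → ¬ E d A X → f X = g X := by
    intro A B X d hAB hA hB hd hX
    obtain ⟨a, ha⟩ := h.exists_dir A X
    obtain ⟨b, hb⟩ := h.exists_dir B X
    have hab : a ≠ b := by
      rintro rfl
      have := h.dir_unique hAB hd (h.trans ha (h.symm hb))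
      exact hX (this ▸ ha)
    refine h.eq_of_dir_ne hab (h.trans (h.symm (hf a A X ha)) ?_)
      (h.trans (h.symm (hf b B X hb)) ?_)
    · rw [hA]; exact hg a A X ha
    · rw [hB]; exact hg b B X hb
  obtain ⟨d, hd⟩ := h.exists_dir A B
  obtain ⟨Z, hZ⟩ := h.exists_off d A
  funext X
  by_cases hX : E d A X
  · by_cases hXA : X = A
    · rw [hXA, hA]
    obtain ⟨e, he⟩ := h.exists_dir A Z
    have hAZ : A ≠ Z := by rintro rfl; exact hZ (h.refl _ _)
    refine key A Z X e hAZ hA (key A B Z d hAB hA hB hd hZ) he fun h1 => ?_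
    have := h.dir_unique (Ne.symm hXA) hX h1
    exact hZ (this ▸ he)
  · exact key A B X d hAB hA hB hd hX

/-- The configuration of Desargues for a pencil of lines. The line of the pencil through an
ordinary point `X` has direction `δ X`; the points in `Z` (the centre of the pencil) are
exceptional. -/
structure IsDesarguesPencil (E : D → P → P → Prop) (δ : P → D) (Z : Set P) : Prop where
  dir_eq : ∀ {X Y}, X ∉ Z → Y ∉ Z → E (δ X) X Y → δ X = δ Y
  center : ∀ {X Y d}, X ∈ Z → Y ∉ Z → E d X Y → d = δ Y
  center_unique : ∀ {X Y}, X ∈ Z → Y ∈ Z → X = Y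
  exists_third : ∀ {A B}, A ∉ Z → B ∉ Z → ∃ C, C ∉ Z ∧ ¬ E (δ C) C A ∧ ¬ E (δ C) C B
  desargues : ∀ {A B C A' B' C' a b c}, A ∉ Z → B ∉ Z → C ∉ Z → A' ∉ Z → B' ∉ Z → C' ∉ Z →
    E (δ A) A A' → E (δ B) B B' → E (δ C) C C' →
    ¬ E (δ A) A B → ¬ E (δ B) B C → ¬ E (δ A) A C →
    E a A B → E a A' B' → E b B C → E b B' C' → E c A C → E c A' C'

/-- A Desarguesian pencil admits a dilation that fixes its lines and maps `A` to any prescribed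
point on the line of the pencil through `A`. -/
theorem IsDesarguesPencil.exists_dilation (h : IsParallelism E) {δ : P → D} {Z : Set P}
    (hp : IsDesarguesPencil E δ Z) {A A' : P} (hA : A ∉ Z) (hA' : A' ∉ Z) (hAA' : E (δ A) A A') :
    ∃ f : P → P, IsDilation E f ∧ f A = A' ∧ (∀ X ∈ Z, f X = X) ∧
      ∀ X ∉ Z, E (δ X) X (f X) := by
  have qsymm : ∀ {X Y}, X ∉ Z → Y ∉ Z → E (δ X) X Y → E (δ Y) Y X := by
    intro X Y hX hY hXY
    rw [← hp.dir_eq hX hY hXY]; exact h.symm hXY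
  have qtrans : ∀ {X Y W}, X ∉ Z → Y ∉ Z → E (δ X) X Y → E (δ Y) Y W → E (δ X) X W := by
    intro X Y W hX hY hXY hYW
    rw [← hp.dir_eq hX hY hXY] at hYW; exact h.trans hXY hYW
  -- corresponding pairs of points
  have step : ∀ A A' X, A ∉ Z → A' ∉ Z → E (δ A) A A' → X ∉ Z → ¬ E (δ A) A X →
      ∃ X', X' ∉ Z ∧ E (δ X) X X' ∧ ∀ a, E a A X → E a A' X' := by
    intro A A' X hA hA' hAA' hX hAX
    obtain ⟨a, ha⟩ := h.exists_dir A X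
    have hne : A ≠ X := by rintro rfl; exact hAX (h.refl _ _)
    have hda : δ X ≠ a := by
      rintro rfl
      exact hAX (qsymm hX hA (h.symm ha))
    obtain ⟨X', h1, h2⟩ := h.meet hda X A'
    refine ⟨X', fun hZ => ?_, h1, fun b hb => ?_⟩
    · have h3 : a = δ A' := hp.center hZ hA' (h.symm h2)
      rw [← hp.dir_eq hA hA' hAA'] at h3
      exact hAX (h3 ▸ ha)
    · rw [h.dir_unique hne hb ha]; exact h2
  obtain ⟨B, hB, hBA, -⟩ := hp.exists_third hA hA
  have hAB : ¬ E (δ A) A B := fun h1 => hBA (qsymm hA hB h1)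
  obtain ⟨B', hB', hBB', hBl⟩ := step A A' B hA hA' hAA' hB hAB
  -- Points off the pencil line of `A` are mapped by means of the pair `A, A'`. Points on that line
  -- are mapped by means of the auxiliary pair `B, B'`.
  have hf : ∀ X, ∃ X', (X ∈ Z → X' = X) ∧ (X ∉ Z → X' ∉ Z ∧ E (δ X) X X' ∧
      (¬ E (δ A) A X → ∀ a, E a A X → E a A' X') ∧
      (E (δ A) A X → ∀ a, E a B X → E a B' X')) := by
    intro X
    by_cases hX : X ∈ Z
    · exact ⟨X, fun _ => rfl, fun h1 => absurd hX h1⟩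
    by_cases hAX : E (δ A) A X
    · have hBX : ¬ E (δ B) B X := fun h1 =>
        hAB (qtrans hA hX hAX (qsymm hB hX h1))
      obtain ⟨X', h1, h2, h3⟩ := step B B' X hB hB' hBB' hX hBX
      exact ⟨X', fun h4 => absurd h4 hX, fun _ => ⟨h1, h2, fun h4 => absurd hAX h4, fun _ => h3⟩⟩
    · obtain ⟨X', h1, h2, h3⟩ := step A A' X hA hA' hAA' hX hAX
      exact ⟨X', fun h4 => absurd h4 hX, fun _ => ⟨h1, h2, fun _ => h3, fun h4 => absurd h4 hAX⟩⟩
  choose f hfZ hf using hf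
  have offZ : ∀ {X}, X ∉ Z → f X ∉ Z := fun hX => (hf _ hX).1
  have fpen : ∀ {X}, X ∉ Z → E (δ X) X (f X) := fun hX => (hf _ hX).2.1
  have fA : f A = A' := by
    obtain ⟨a, ha⟩ := h.exists_dir B A
    have h1 := (hf A hA).2.2.2 (h.refl _ _) a ha
    have h2 := hBl a (h.symm ha)
    refine h.eq_of_dir_ne (d := δ A) (e := a) ?_ ?_ (h.trans (h.symm h1) (h.symm h2))
    · rintro rfl; exact hAB (h.symm ha)
    · exact h.trans (h.symm (fpen hA)) hAA'
  have fB : f B = B' := by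
    obtain ⟨a, ha⟩ := h.exists_dir A B
    have h1 := (hf B hB).2.2.1 hAB a ha
    refine h.eq_of_dir_ne (d := δ B) (e := a) ?_ ?_ (h.trans (h.symm h1) (hBl a ha))
    · rintro rfl; exact hBA (h.symm ha)
    · exact h.trans (h.symm (fpen hB)) hBB'
  -- pairs on one line of the pencil
  have same : ∀ {X Y c}, X ∉ Z → Y ∉ Z → X ≠ Y → E (δ X) X Y → E c X Y → E c (f X) (f Y) := by
    intro X Y c hX hY hXY h1 hc
    rw [h.dir_unique hXY hc h1]
    refine h.trans (h.symm (fpen hX)) (h.trans h1 ?_)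
    rw [hp.dir_eq hX hY h1]; exact fpen hY
  -- Desargues
  have des : ∀ {W X Y}, W ∉ Z → X ∉ Z → Y ∉ Z → ¬ E (δ W) W X → ¬ E (δ W) W Y →
      (∀ a, E a W X → E a (f W) (f X)) → (∀ a, E a W Y → E a (f W) (f Y)) →
      ∀ c, E c X Y → E c (f X) (f Y) := by
    intro W X Y hW hX hY hWX hWY h1 h2 c hc
    by_cases hXY : X = Y
    · subst hXY; exact h.refl _ _
    by_cases hq : E (δ X) X Y
    · exact same hX hY hXY hq hc
    obtain ⟨a, ha⟩ := h.exists_dir W X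
    obtain ⟨b, hb⟩ := h.exists_dir W Y
    exact hp.desargues hX hW hY (offZ hX) (offZ hW) (offZ hY) (fpen hX) (fpen hW) (fpen hY)
      (fun h3 => hWX (qsymm hX hW h3)) hWY hq (h.symm ha) (h.symm (h1 a ha)) hb (h2 b hb) hc
  have lA : ∀ {X}, X ∉ Z → ¬ E (δ A) A X → ∀ a, E a A X → E a (f A) (f X) := by
    intro X hX hAX; rw [fA]; exact (hf X hX).2.2.1 hAX
  have lB : ∀ {X}, X ∉ Z → E (δ A) A X → ∀ a, E a B X → E a (f B) (f X) := by
    intro X hX hAX; rw [fB]; exact (hf X hX).2.2.2 hAX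
  have sym : ∀ {X Y}, (∀ a, E a X Y → E a (f X) (f Y)) → ∀ a, E a Y X → E a (f Y) (f X) :=
    fun h1 a ha => h.symm (h1 a (h.symm ha))
  have mixed : ∀ {X Y}, X ∉ Z → Y ∉ Z → E (δ A) A X → ¬ E (δ A) A Y →
      ∀ c, E c X Y → E c (f X) (f Y) := by
    intro X Y hX hY hAX hAY
    have hBX : ¬ E (δ B) B X := fun h1 => hAB (qtrans hA hX hAX (qsymm hB hX h1))
    have gen : ∀ {Y}, Y ∉ Z → ¬ E (δ A) A Y → ¬ E (δ B) B Y →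
        ∀ c, E c X Y → E c (f X) (f Y) := by
      intro Y hY hAY hBY
      exact des hB hX hY hBX hBY (lB hX hAX) (des hA hB hY hAB hAY (lA hB hAB) (lA hY hAY))
    -- If `Y` lies on the pencil line of `B`, Desargues cannot be applied from `B`; a point `C` on a
    -- third pencil line takes its place.
    by_cases hBY : E (δ B) B Y
    · obtain ⟨C, hC, hCA, hCB⟩ := hp.exists_third hA hB
      have hAC : ¬ E (δ A) A C := fun h1 => hCA (qsymm hA hC h1)
      have hBC : ¬ E (δ B) B C := fun h1 => hCB (qsymm hB hC h1)
      have hCX : ¬ E (δ C) C X := fun h1 => hCA (qtrans hC hX h1 (qsymm hA hX hAX))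
      have hCY : ¬ E (δ C) C Y := fun h1 => hCB (qtrans hC hY h1 (qsymm hB hY hBY))
      exact des hC hX hY hCX hCY (sym (gen hC hAC hBC))
        (des hA hC hY hAC hAY (lA hC hAC) (lA hY hAY))
    · exact gen hY hAY hBY
  refine ⟨f, fun d X Y hd => ?_, fA, hfZ, fun X hX => fpen hX⟩
  by_cases hXY : X = Y
  · subst hXY; exact h.refl _ _
  by_cases hX : X ∈ Z
  · by_cases hY : Y ∈ Z
    · exact absurd (hp.center_unique hX hY) hXY
    · rw [hfZ X hX]
      refine h.trans hd ?_
      rw [hp.center hX hY hd]; exact fpen hY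
  by_cases hY : Y ∈ Z
  · rw [hfZ Y hY]
    refine h.trans (h.symm ?_) hd
    rw [hp.center hY hX (h.symm hd)]; exact fpen hX
  by_cases hAX : E (δ A) A X
  · by_cases hAY : E (δ A) A Y
    · exact same hX hY hXY (qtrans hX hA (qsymm hA hX hAX) hAY) hd
    · exact mixed hX hY hAX hAY d hd
  · by_cases hAY : E (δ A) A Y
    · exact sym (mixed hY hX hAY hAX) d hd
    · exact des hA hX hY hAX hAY (lA hX hAX) (lA hY hAY) d hd

end IsParallelism

/-! ### Translations and homotheties -/

namespace IsParallelism

variable {P D : Type*} {E : D → P → P → Prop}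

/-- The parallel form of the axiom of Desargues in terms of directions. -/
def _root_.ParallelDesarguesDir (E : D → P → P → Prop) : Prop :=
  ∀ ⦃d a b c A B C A' B' C'⦄, E d A A' → E d B B' → E d C C' →
    ¬ E d A B → ¬ E d B C → ¬ E d A C →
    E a A B → E a A' B' → E b B C → E b B' C' → E c A C → E c A' C'

/-- The concurrent form of the axiom of Desargues in terms of directions. -/
def _root_.ConcurrentDesarguesDir (E : D → P → P → Prop) : Prop :=
  ∀ ⦃O k l m a b c A B C A' B' C'⦄, A ≠ O → B ≠ O → C ≠ O → A' ≠ O → B' ≠ O → C' ≠ O →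
    E k O A → E k O A' → E l O B → E l O B' → E m O C → E m O C' → k ≠ l → l ≠ m → k ≠ m →
    E a A B → E a A' B' → E b B C → E b B' C' → E c A C → E c A' C'

/-- A translation: a dilation that moves all points along one direction. -/
def _root_.IsTranslation (E : D → P → P → Prop) (f : P → P) : Prop :=
  IsDilation E f ∧ ∃ d, ∀ X, E d X (f X)

theorem isTranslation_id (h : IsParallelism E) (A : P) : IsTranslation E (id : P → P) := by
  obtain ⟨d, -⟩ := h.exists_dir A A
  exact ⟨fun _ _ _ h1 => h1, d, fun X => h.refl d X⟩

theorem exists_translation (h : IsParallelism E) (hp : ParallelDesarguesDir E) (A A' : P) :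
    ∃ f, IsTranslation E f ∧ f A = A' := by
  obtain ⟨d, hd⟩ := h.exists_dir A A'
  have hpen : IsDesarguesPencil E (fun _ => d) (∅ : Set P) := by
    refine ⟨fun _ _ _ => rfl, fun hX => absurd hX (Set.notMem_empty _),
      fun hX => absurd hX (Set.notMem_empty _), fun {A B} _ _ => ?_, ?_⟩
    · obtain ⟨e, hed, -⟩ := h.exists_dir_ne_ne d d
      obtain ⟨B', h1, h2⟩ := h.meet hed A B
      obtain ⟨C, hC, hCA, hCB⟩ := h.exists_ne_ne e A B'
      refine ⟨C, Set.notMem_empty _, fun h3 => hCA (h.eq_of_dir_ne hed (h.symm hC) h3),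
        fun h3 => hCB (h.eq_of_dir_ne hed (h.trans (h.symm hC) h1) (h.trans h3 h2))⟩
    · intro A B C A' B' C' a b c _ _ _ _ _ _
      exact @hp d a b c A B C A' B' C'
  obtain ⟨f, hf, hfA, -, hfX⟩ := hpen.exists_dilation h (Set.notMem_empty A)
    (Set.notMem_empty A') hd
  exact ⟨f, ⟨hf, d, fun X => hfX X (Set.notMem_empty X)⟩, hfA⟩

theorem exists_homothety (h : IsParallelism E) (hc : ConcurrentDesarguesDir E) {O A A' : P} {d : D}
    (hA : A ≠ O) (hd : E d O A) (hd' : E d O A') : ∃ f, IsDilation E f ∧ f O = O ∧ f A = A' := by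
  by_cases hA' : A' = O
  · exact ⟨fun _ => O, fun d _ _ _ => h.refl d O, rfl, hA'.symm⟩
  choose δ hδ using fun X => h.exists_dir O X
  have hδu : ∀ {X d}, X ≠ O → E d O X → d = δ X := fun hX h1 =>
    h.dir_unique (Ne.symm hX) h1 (hδ _)
  have hpen : IsDesarguesPencil E δ ({O} : Set P) := by
    refine ⟨fun {X Y} hX hY hXY => hδu hY (h.trans (hδ X) hXY), fun {X Y d} hX hY hXY => ?_,
      fun hX hY => hX.trans hY.symm, fun {A B} hA hB => ?_, ?_⟩
    · obtain rfl : X = O := hX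
      exact hδu hY hXY
    · obtain ⟨e, h1, h2⟩ := h.exists_dir_ne_ne (δ A) (δ B)
      obtain ⟨C, hC, hCO⟩ := h.exists_ne e O
      have hne : ∀ A, e ≠ δ A → A ≠ O → ¬ E (δ C) C A := fun A h1 hA h2 =>
        h1 ((hδu hCO hC).trans (hδu hA (h.trans (hδ C) h2)))
      exact ⟨C, hCO, hne A h1 hA, hne B h2 hB⟩
    · intro A B C A' B' C' a b c hA hB hC hA' hB' hC' hAA' hBB' hCC' hAB hBC hAC
      have hne : ∀ {A B}, ¬ E (δ A) A B → δ A ≠ δ B := fun {A B} h1 h2 =>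
        h1 (h.trans (h.symm (hδ A)) (h2 ▸ hδ B))
      exact hc hA hB hC hA' hB' hC' (hδ A) (h.trans (hδ A) hAA') (hδ B) (h.trans (hδ B) hBB')
        (hδ C) (h.trans (hδ C) hCC') (hne hAB) (hne hBC) (hne hAC)
  have hdA := hδu hA hd
  obtain ⟨f, hf, hfA, hfO, -⟩ := hpen.exists_dilation h (A := A) (A' := A') hA hA'
    (hdA ▸ h.trans (h.symm hd) hd')
  exact ⟨f, hf, hfO O rfl, hfA⟩

theorem translation_eq_of_dir (h : IsParallelism E) {f g : P → P} (hf : IsDilation E f)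
    (hg : IsDilation E g) {d : D} (hfd : ∀ X, E d X (f X)) (hgd : ∀ X, E d X (g X)) {A : P}
    (hA : f A = g A) : f = g := by
  obtain ⟨Y, hY⟩ := h.exists_off d A
  obtain ⟨e, he⟩ := h.exists_dir A Y
  refine h.dilation_ext hf hg (A := A) (B := Y) ?_ hA ?_
  · rintro rfl; exact hY (h.refl _ _)
  refine h.eq_of_dir_ne (d := d) (e := e) ?_ (h.trans (h.symm (hfd Y)) (hgd Y)) ?_
  · rintro rfl; exact hY he
  · have h1 := hf e A Y he
    rw [hA] at h1
    exact h.trans (h.symm h1) (hg e A Y he)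

/-- A translation is determined by the image of one point. -/
theorem translation_ext (h : IsParallelism E) {f g : P → P} (hf : IsTranslation E f)
    (hg : IsTranslation E g) {A : P} (hA : f A = g A) : f = g := by
  obtain ⟨hf, d, hfd⟩ := hf
  obtain ⟨hg, e, hge⟩ := hg
  by_cases hde : d = e
  · subst hde; exact h.translation_eq_of_dir hf hg hfd hge hA
  -- Distinct directions force `A` to be a common fixed point, so both maps are the identity.
  have hA' : A = f A := h.eq_of_dir_ne hde (hfd A) (hA ▸ hge A)
  have hid : IsDilation E (id : P → P) := fun _ _ _ h1 => h1
  rw [h.translation_eq_of_dir hf hid hfd (fun X => h.refl d X) hA'.symm,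
    h.translation_eq_of_dir hg hid hge (fun X => h.refl e X) (hA.symm.trans hA'.symm)]

/-- A dilation without fixed points is a translation. -/
theorem isTranslation_of_forall_ne (h : IsParallelism E) {f : P → P} (hf : IsDilation E f)
    (hfix : ∀ X, f X ≠ X) (A : P) : IsTranslation E f := by
  obtain ⟨d, hd⟩ := h.exists_dir A (f A)
  refine ⟨hf, d, fun Y => ?_⟩
  obtain ⟨e, he⟩ := h.exists_dir Y (f Y)
  by_cases hde : d = e
  · subst hde; exact he
  -- The lines joining `A` and `Y` to their images are mapped into themselves, so their intersection
  -- `Z` would be fixed.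
  obtain ⟨Z, h1, h2⟩ := h.meet hde A Y
  refine absurd ?_ (hfix Z)
  exact h.eq_of_dir_ne hde (h.trans (h.symm (hf d A Z h1)) (h.trans (h.symm hd) h1))
    (h.trans (h.symm (hf e Y Z h2)) (h.trans (h.symm he) h2))

/-- A composite without fixed points is a translation by the previous lemma. If it fixes `X`, then
`f` undoes `g` at `X`, so either `g` is the identity or both have the same direction. -/
theorem isTranslation_comp (h : IsParallelism E) {f g : P → P} (hf : IsTranslation E f)
    (hg : IsTranslation E g) (A : P) : IsTranslation E (f ∘ g) := by
  have hfg : IsDilation E (f ∘ g) := fun d X Y h1 => hf.1 d _ _ (hg.1 d X Y h1)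
  by_cases hfix : ∀ X, (f ∘ g) X ≠ X
  · exact h.isTranslation_of_forall_ne hfg hfix A
  push Not at hfix
  obtain ⟨X, hX⟩ := hfix
  have hid := h.isTranslation_id A
  by_cases hgX : g X = X
  · have h1 : g = id := h.translation_ext hg hid hgX
    rw [h1]; exact hf
  obtain ⟨-, d, hd⟩ := hf
  obtain ⟨-, e, he⟩ := hg
  have h1 := hd (g X)
  rw [show f (g X) = X from hX] at h1
  obtain rfl : d = e := h.dir_unique hgX h1 (h.symm (he X))
  exact ⟨hfg, d, fun Y => h.trans (he Y) (hd (g Y))⟩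

/-- For different directions, `f (g X)` and `g (f X)` are both the fourth vertex of the
parallelogram on `X`, `f X`, `g X`. For equal directions, a translation `t` in another direction
helps: `g` commutes with `t` and with `f ∘ t`, hence with `f`. -/
theorem translation_comm (h : IsParallelism E) (hp : ParallelDesarguesDir E) {f g : P → P}
    (hf : IsTranslation E f) (hg : IsTranslation E g) (X : P) : f (g X) = g (f X) := by
  have key : ∀ {f g : P → P} {d e : D}, IsDilation E f → IsDilation E g → (∀ X, E d X (f X)) →
      (∀ X, E e X (g X)) → d ≠ e → ∀ X, f (g X) = g (f X) := by
    intro f g d e hf hg hfd hge hde X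
    exact h.eq_of_dir_ne hde (h.trans (h.symm (hfd (g X))) (hg d _ _ (hfd X)))
      (h.trans (h.symm (hf e _ _ (hge X))) (hge (f X)))
  obtain ⟨d, hfd⟩ := hf.2
  obtain ⟨e, hge⟩ := hg.2
  by_cases hde : d = e
  · subst hde
    obtain ⟨e, hed, -⟩ := h.exists_dir_ne_ne d d
    obtain ⟨W, hW, hWX⟩ := h.exists_ne e X
    obtain ⟨t, ht, htX⟩ := h.exists_translation hp X W
    obtain ⟨e', hte⟩ := ht.2
    obtain rfl : e = e' := h.dir_unique (Ne.symm hWX) hW (htX ▸ hte X)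
    obtain ⟨hft, c, hc⟩ := h.isTranslation_comp hf ht X
    have hcd : c ≠ d := by
      rintro rfl
      exact hWX (h.eq_of_dir_ne hed hW
        (h.trans (hc X) (h.symm (by simpa [htX] using hfd (t X))))).symm
    have h1 := key hft hg.1 hc hge hcd X
    have h2 := key ht.1 hg.1 hte hge hed X
    simp only [Function.comp_apply] at h1
    rw [h2] at h1
    exact congrFun (h.translation_ext (h.isTranslation_comp hf hg X) (h.isTranslation_comp hg hf X)
      (A := t X) (by simpa using h1)) X
  · exact key hf.1 hg.1 hfd hge hde X

end IsParallelism

/-! ### The group of points, its kernel and coordinates -/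

namespace IsParallelism

variable {P D : Type*} {E : D → P → P → Prop}

/-- The translations make the points an abelian group with any prescribed zero. -/
theorem exists_addCommGroup (h : IsParallelism E) (hp : ParallelDesarguesDir E) (O : P) :
    ∃ G : AddCommGroup P, G.zero = O ∧
      ∀ A d X Y, E d X Y → E d (G.add A X) (G.add A Y) := by
  choose τ hτ hτO using h.exists_translation hp O
  choose ν hν hνO using fun A => h.exists_translation hp A O
  let _ : Zero P := ⟨O⟩
  -- `A + B` is the image of `B` under the translation that takes `O` to `A`; the group laws follow
  -- by comparing translations at one point.
  let _ : Add P := ⟨fun A B => τ A B⟩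
  let _ : Neg P := ⟨fun A => ν A O⟩
  have assoc : ∀ A B C : P, A + B + C = A + (B + C) := fun A B C =>
    congrFun (h.translation_ext (hτ (τ A B)) (h.isTranslation_comp (hτ A) (hτ B) O) (A := O)
      (by simp [hτO])) C
  have zero_add : ∀ A : P, 0 + A = A := fun A =>
    congrFun (h.translation_ext (hτ O) (h.isTranslation_id O) (hτO O)) A
  have neg_add : ∀ A : P, -A + A = 0 := fun A => by
    have h1 : τ (ν A O) = ν A := h.translation_ext (hτ _) (hν A) (hτO _)
    exact (congrFun h1 A).trans (hνO A)
  have comm : ∀ A B : P, A + B = B + A := fun A B => by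
    have h1 := h.translation_comm hp (hτ A) (hτ B) O
    rw [hτO, hτO] at h1
    exact h1
  let G : AddGroup P := AddGroup.ofLeftAxioms assoc zero_add neg_add
  exact ⟨{ G with add_comm := comm }, rfl, fun A d X Y h1 => (hτ A).1 d X Y h1⟩

section Group

variable [AddCommGroup P]

theorem add_left (h : IsParallelism E) (hT : ∀ (A : P) d X Y, E d X Y → E d (A + X) (A + Y))
    {d : D} {X Y : P} (hX : E d 0 X) (hY : E d 0 Y) : E d 0 (X + Y) := by
  have h1 := hT X d 0 Y hY
  rw [add_zero] at h1
  exact h.trans hX h1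

theorem neg_mem (h : IsParallelism E) (hT : ∀ (A : P) d X Y, E d X Y → E d (A + X) (A + Y))
    {d : D} {X : P} (hX : E d 0 X) : E d 0 (-X) := by
  have h1 := hT (-X) d 0 X hX
  rw [add_zero, neg_add_cancel] at h1
  exact h.symm h1

theorem iff_sub (hT : ∀ (A : P) d X Y, E d X Y → E d (A + X) (A + Y))
    {d : D} {X Y : P} : E d X Y ↔ E d 0 (Y - X) := by
  constructor
  · intro h1
    have h2 := hT (-X) d X Y h1
    rwa [neg_add_cancel, neg_add_eq_sub] at h2
  · intro h1
    have h2 := hT X d _ _ h1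
    rwa [add_zero, add_sub_cancel] at h2

/-- The endomorphisms of the group of points that map every line through `0` into itself. -/
def kernel (h : IsParallelism E) (hT : ∀ (A : P) d X Y, E d X Y → E d (A + X) (A + Y)) :
    Subring (AddMonoid.End P) where
  carrier := {f | ∀ d X, E d 0 X → E d 0 (f X)}
  mul_mem' := fun hf hg d X hX => hf d _ (hg d X hX)
  one_mem' := fun _ _ hX => hX
  add_mem' := fun hf hg d X hX => h.add_left hT (hf d X hX) (hg d X hX)
  zero_mem' := fun d _ _ => h.refl d 0
  neg_mem' := fun hf d X hX => h.neg_mem hT (hf d X hX)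

/-- Such an `f` is a dilation that agrees with the constant dilation `0` at the two points `0` and
`A`. This makes the kernel a domain. -/
theorem eq_zero_of_apply_eq_zero (h : IsParallelism E)
    (hT : ∀ (A : P) d X Y, E d X Y → E d (A + X) (A + Y)) {f : AddMonoid.End P}
    (hf : ∀ d X, E d 0 X → E d 0 (f X)) {A : P} (hA : A ≠ 0) (hfA : f A = 0) : f = 0 := by
  have hdil : IsDilation E f := by
    intro d X Y h1
    rw [iff_sub hT] at h1 ⊢
    rw [← map_sub]
    exact hf d _ h1
  have h0 : IsDilation E ((0 : AddMonoid.End P) : P → P) := fun d _ _ _ => h.refl d 0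
  exact DFunLike.coe_injective (h.dilation_ext hdil h0 hA hfA (map_zero f))

/-- A dilation that fixes `0` is additive. -/
theorem dilation_add (h : IsParallelism E)
    (hT : ∀ (A : P) d X Y, E d X Y → E d (A + X) (A + Y)) {f : P → P} (hf : IsDilation E f)
    (hf0 : f 0 = 0) (X Y : P) : f (X + Y) = f X + f Y := by
  by_cases hX0 : X = 0
  · simp [hX0, hf0]
  obtain ⟨d, hd⟩ := h.exists_dir 0 X
  obtain ⟨W, hW⟩ := h.exists_off d 0
  obtain ⟨e, he⟩ := h.exists_dir 0 W
  have hde : d ≠ e := by rintro rfl; exact hW he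
  -- This dilation agrees with `f` at `0` and, by the parallelogram on `X` and `W`, at a point `W`
  -- off the line `0X`; hence it equals `f`.
  have hg : IsDilation E (fun Y => -f X + f (X + Y)) := fun c A B h1 =>
    hT _ _ _ _ (hf _ _ _ (hT X _ _ _ h1))
  have hW0 : (0 : P) ≠ W := by rintro rfl; exact hW (h.refl _ _)
  have key : (fun Y => -f X + f (X + Y)) = f := by
    refine h.dilation_ext hg hf hW0 (by simp [hf0]) ?_
    refine h.eq_of_dir_ne hde ?_ ?_
    · have h1 := hT W d 0 X hd
      rw [add_zero, add_comm] at h1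
      have h2 : E d 0 (f X) := by simpa only [hf0] using hf d 0 X hd
      have h3 := hT (f (X + W)) d 0 _ (h.neg_mem hT h2)
      rw [add_zero, add_comm _ (-f X)] at h3
      exact h.trans (h.symm h3) (h.symm (hf d _ _ h1))
    · have h1 := hT (-f X) _ _ _ (hf _ _ _ (hT X e 0 W he))
      rw [add_zero, neg_add_cancel] at h1
      have h2 : E e 0 (f W) := by simpa only [hf0] using hf e 0 W he
      exact h.trans (h.symm h1) h2
  have h1 := congrFun key Y
  change -f X + f (X + Y) = f Y at h1
  rw [← h1, add_neg_cancel_left]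

theorem exists_mem_kernel (h : IsParallelism E)
    (hT : ∀ (A : P) d X Y, E d X Y → E d (A + X) (A + Y)) (hc : ConcurrentDesarguesDir E)
    {A B : P} {d : D} (hA : A ≠ 0) (hdA : E d 0 A) (hdB : E d 0 B) :
    ∃ f ∈ h.kernel hT, f A = B := by
  obtain ⟨f, hf, hf0, hfA⟩ := h.exists_homothety hc hA hdA hdB
  refine ⟨⟨⟨f, hf0⟩, h.dilation_add hT hf hf0⟩, fun d X hX => ?_, hfA⟩
  have h1 := hf d 0 X hX
  rwa [hf0] at h1

theorem isDomain_kernel (h : IsParallelism E)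
    (hT : ∀ (A : P) d X Y, E d X Y → E d (A + X) (A + Y)) {A : P} (hA : A ≠ 0) :
    IsDomain (h.kernel hT) := by
  have : Nontrivial (h.kernel hT) := by
    refine ⟨0, 1, fun h1 => hA ?_⟩
    have h2 := DFunLike.congr_fun (congrArg Subtype.val h1) A
    exact h2.symm
  have : NoZeroDivisors (h.kernel hT) := by
    refine ⟨fun {a b} hab => ?_⟩
    have h1 : ∀ X, a.1 (b.1 X) = 0 := fun X => DFunLike.congr_fun (congrArg Subtype.val hab) X
    by_cases hb : b.1 A = 0
    · exact Or.inr (Subtype.ext (h.eq_zero_of_apply_eq_zero hT b.2 hA hb))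
    · exact Or.inl (Subtype.ext (h.eq_zero_of_apply_eq_zero hT a.2 hb (h1 A)))
  exact NoZeroDivisors.to_isDomain _

end Group

/-- Coordinates over a field: in a finite Desarguesian plane, with respect to any two axes through a
common point `O`. -/
theorem exists_coordinates.{u, v} {P : Type u} {D : Type v} {E : D → P → P → Prop} [Finite P] (h : IsParallelism E) (hp : ParallelDesarguesDir E)
    (hc : ConcurrentDesarguesDir E) (O : P) {d e : D} (hde : d ≠ e) :
    ∃ (K : Type u) (_ : Field K) (x y : P → K),
      (∀ A, x A = 0 ↔ E e O A) ∧ (∀ A, y A = 0 ↔ E d O A) ∧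
      (∀ A B, x A = x B → y A = y B → A = B) ∧
      ∀ A B C F, (∃ c, E c A B ∧ E c C F) ↔
        (x B - x A) * (y F - y C) = (y B - y A) * (x F - x C) := by
  obtain ⟨G, rfl, hT⟩ := h.exists_addCommGroup hp O
  replace hT : ∀ (A : P) d X Y, E d X Y → E d (A + X) (A + Y) := hT
  obtain ⟨v, hv, hv0⟩ := h.exists_ne d (0 : P)
  obtain ⟨w, hw, hw0⟩ := h.exists_ne e (0 : P)
  have := h.isDomain_kernel hT hv0
  have : Finite (AddMonoid.End P) := DFunLike.finite _
  let K := h.kernel hT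
  -- Wedderburn's little theorem; `v` and `w` then form a basis over `K`, one vector on each axis.
  have hK : IsField K := Finite.isDomain_to_isField K
  let _ : Field K := hK.toField
  have smul_mem : ∀ (a : K) {c X}, E c 0 X → E c 0 (a • X) := fun a {c X} h1 => a.2 c X h1
  have smul_eq : ∀ (a : K) {X : P}, X ≠ 0 → a • X = 0 → a = 0 := fun a {X} hX h1 =>
    Subtype.ext (h.eq_zero_of_apply_eq_zero hT a.2 hX h1)
  have ex_smul : ∀ {c A B}, A ≠ 0 → E c 0 A → E c 0 B → ∃ a : K, a • A = B := by
    intro c A B hA h1 h2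
    obtain ⟨f, hf, hfA⟩ := h.exists_mem_kernel hT hc hA h1 h2
    exact ⟨⟨f, hf⟩, hfA⟩
  have hxy : ∀ A : P, ∃ a b : K, a • v + b • w = A := by
    intro A
    obtain ⟨B, h1, h2⟩ := h.meet hde 0 A
    obtain ⟨a, ha⟩ := ex_smul hv0 hv h1
    rw [iff_sub hT] at h2
    obtain ⟨b, hb⟩ := ex_smul hw0 hw (h.neg_mem hT h2)
    exact ⟨a, b, by rw [ha, hb]; abel⟩
  choose x y hxy using hxy
  have indep : ∀ a b : K, a • v + b • w = 0 → a = 0 ∧ b = 0 := by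
    intro a b h1
    have h2 : a • v = -(b • w) := eq_neg_of_add_eq_zero_left h1
    have h3 : (0 : P) = a • v := h.eq_of_dir_ne hde (smul_mem a hv)
      (by rw [h2]; exact h.neg_mem hT (smul_mem b hw))
    have ha := smul_eq a hv0 h3.symm
    rw [← h3, zero_add] at h1
    exact ⟨ha, smul_eq b hw0 h1⟩
  have uniq : ∀ a b A, a • v + b • w = A → x A = a ∧ y A = b := by
    intro a b A h1
    have h2 := indep (x A - a) (y A - b) (by
      rw [sub_smul, sub_smul, sub_add_sub_comm, hxy, h1, sub_self])
    exact ⟨sub_eq_zero.1 h2.1, sub_eq_zero.1 h2.2⟩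
  have sub : ∀ A B, x (B - A) = x B - x A ∧ y (B - A) = y B - y A := by
    intro A B
    refine uniq _ _ _ ?_
    rw [sub_smul, sub_smul, sub_add_sub_comm, hxy, hxy]
  have smul : ∀ (a : K) A, x (a • A) = a * x A ∧ y (a • A) = a * y A := by
    intro a A
    refine uniq _ _ _ ?_
    rw [mul_smul, mul_smul, ← smul_add, hxy]
  have inj : ∀ A B, x A = x B → y A = y B → A = B := by
    intro A B h1 h2
    rw [← hxy A, ← hxy B, h1, h2]
  have x0 : x 0 = 0 ∧ y 0 = 0 := uniq 0 0 0 (by simp)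
  refine ⟨K, inferInstance, x, y, fun A => ⟨fun h1 => ?_, fun h1 => ?_⟩,
    fun A => ⟨fun h1 => ?_, fun h1 => ?_⟩, inj, fun A B C F => ⟨?_, fun h1 => ?_⟩⟩
  · have h2 := hxy A
    rw [h1, zero_smul, zero_add] at h2
    rw [← h2]; exact smul_mem _ hw
  · obtain ⟨a, ha⟩ := ex_smul hw0 hw h1
    exact (uniq 0 a A (by rw [zero_smul, zero_add, ha])).1
  · have h2 := hxy A
    rw [h1, zero_smul, add_zero] at h2
    rw [← h2]; exact smul_mem _ hv
  · obtain ⟨a, ha⟩ := ex_smul hv0 hv h1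
    exact (uniq a 0 A (by rw [zero_smul, add_zero, ha])).2
  · rintro ⟨c, h1, h2⟩
    rw [iff_sub hT] at h1 h2
    rw [← (sub A B).1, ← (sub A B).2, ← (sub C F).1, ← (sub C F).2]
    by_cases hAB : B - A = 0
    · rw [hAB, x0.1, x0.2, zero_mul, zero_mul]
    obtain ⟨a, ha⟩ := ex_smul hAB h1 h2
    rw [← ha, (smul a _).1, (smul a _).2]
    ring
  · rw [← (sub A B).1, ← (sub A B).2, ← (sub C F).1, ← (sub C F).2] at h1
    by_cases hAB : B - A = 0
    · obtain ⟨c, hcd⟩ := h.exists_dir C F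
      exact ⟨c, (iff_sub hT).2 (hAB ▸ h.refl c 0), hcd⟩
    obtain ⟨c, hAc⟩ := h.exists_dir 0 (B - A)
    refine ⟨c, (iff_sub hT).2 hAc, (iff_sub hT).2 ?_⟩
    -- With vanishing determinant, `F - C` is a multiple of `B - A`; the scalar is read off from a
    -- nonzero coordinate of `B - A`.
    have key : ∃ a : K, a • (B - A) = F - C := by
      by_cases hx : x (B - A) = 0
      · have hy : y (B - A) ≠ 0 := fun hy => hAB (inj _ _ (hx.trans x0.1.symm) (hy.trans x0.2.symm))
        refine ⟨y (F - C) / y (B - A), inj _ _ ?_ ?_⟩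
        · rw [(smul _ _).1]; field_simp; linear_combination h1
        · rw [(smul _ _).2]; field_simp
      · refine ⟨x (F - C) / x (B - A), inj _ _ ?_ ?_⟩
        · rw [(smul _ _).1]; field_simp
        · rw [(smul _ _).2]; field_simp; linear_combination -h1
    obtain ⟨a, ha⟩ := key
    rw [← ha]; exact smul_mem a hAc

end IsParallelism

/-! ### Pappus' theorem as identities over a field -/

section PappusAlgebra

variable {K : Type*} [Field K]

theorem inv_sub_inv_ne {a b : K} (h : a ≠ b) : a⁻¹ - b⁻¹ ≠ 0 :=
  sub_ne_zero.2 fun h1 => h (inv_injective h1)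

theorem line_eq_of_intercepts {a b x y : K} (ha : a ≠ 0) (hb : b ≠ 0)
    (h : (0 - a) * (y - 0) = (b - 0) * (x - a)) : a⁻¹ * x + b⁻¹ * y = 1 := by
  field_simp
  linear_combination -h

/-- Subtracting the two equations shows that `(x, y)` is proportional to `(v₁ - v₂, u₁ - u₂)`. The
factor in the last clause equals `u₁v₁ - u₂v₂`. -/
theorem exists_scale {u₁ u₂ v₁ v₂ x y : K} (hu : u₁ - u₂ ≠ 0) (h₁ : u₁ * x + v₂ * y = 1)
    (h₂ : u₂ * x + v₁ * y = 1) :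
    ∃ t, x = t * (v₁ - v₂) ∧ y = t * (u₁ - u₂) ∧
      t * (u₁ * (v₁ - v₂) + v₂ * (u₁ - u₂)) = 1 := by
  have hy : y = y / (u₁ - u₂) * (u₁ - u₂) := by field_simp
  have hx : x = y / (u₁ - u₂) * (v₁ - v₂) := by
    field_simp; linear_combination h₁ - h₂
  refine ⟨y / (u₁ - u₂), hx, hy, ?_⟩
  linear_combination h₁ - u₁ * hx - v₂ * hy

/-- Here `uᵢ`, `vⱼ` are the reciprocal intercepts of `aᵢ`, `bⱼ` on the axes. The intersections have
homogeneous coordinates `(vᵢ - vⱼ, uᵢ - uⱼ, uᵢvᵢ - uⱼvⱼ)`, and the vector for 13 is the sum of those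
for 12 and 23. The relation `key` is the third coordinate of this sum, `1/r = 1/t + 1/s`. -/
theorem pappus_axes {u₁ u₂ u₃ v₁ v₂ v₃ x y x' y' x'' y'' : K} (h12 : u₁ - u₂ ≠ 0)
    (h23 : u₂ - u₃ ≠ 0) (h13 : u₁ - u₃ ≠ 0)
    (hX : u₁ * x + v₂ * y = 1) (hX' : u₂ * x + v₁ * y = 1)
    (hY : u₂ * x' + v₃ * y' = 1) (hY' : u₃ * x' + v₂ * y' = 1)
    (hZ : u₁ * x'' + v₃ * y'' = 1) (hZ' : u₃ * x'' + v₁ * y'' = 1) :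
    (x' - x) * (y'' - y) = (y' - y) * (x'' - x) := by
  obtain ⟨t, rfl, rfl, ht⟩ := exists_scale h12 hX hX'
  obtain ⟨s, rfl, rfl, hs⟩ := exists_scale h23 hY hY'
  obtain ⟨r, rfl, rfl, hr⟩ := exists_scale h13 hZ hZ'
  have key : t * s - s * r - r * t = 0 := by
    linear_combination -(t * s) * hr + s * r * ht + r * t * hs
  linear_combination ((v₁ - v₂) * (u₂ - u₃) - (u₁ - u₂) * (v₂ - v₃)) * key

/-- By `hpar` the scale factors satisfy `s = -t`, so the difference of the two intersections is
proportional to `(v₁ - v₃, u₁ - u₃)`, which is parallel to the line with coefficients `u₁, v₃`. -/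
theorem pappus_axes_one_parallel {u₁ u₂ u₃ v₁ v₂ v₃ x y x' y' : K} (h12 : u₁ - u₂ ≠ 0)
    (h23 : u₂ - u₃ ≠ 0)
    (hX : u₁ * x + v₂ * y = 1) (hX' : u₂ * x + v₁ * y = 1)
    (hY : u₂ * x' + v₃ * y' = 1) (hY' : u₃ * x' + v₂ * y' = 1) (hpar : u₁ * v₁ = u₃ * v₃) :
    u₁ * (x' - x) + v₃ * (y' - y) = 0 := by
  obtain ⟨t, rfl, rfl, ht⟩ := exists_scale h12 hX hX'
  obtain ⟨s, rfl, rfl, hs⟩ := exists_scale h23 hY hY'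
  have key : (u₁ * (v₂ - v₃) + v₃ * (u₂ - u₃)) * (u₁ * (v₁ - v₂) + v₂ * (u₁ - u₂)) =
      (u₁ * (v₁ - v₂) + v₃ * (u₁ - u₂)) * (u₂ * (v₂ - v₃) + v₃ * (u₂ - u₃)) := by
    linear_combination (u₁ - u₂) * (v₂ - v₃) * hpar
  linear_combination t * s * key - s * (u₁ * (v₂ - v₃) + v₃ * (u₂ - u₃)) * ht
    + t * (u₁ * (v₁ - v₂) + v₃ * (u₁ - u₂)) * hs

theorem intersection_of_parallel_axes {a₁ a₂ b₁ b₂ c x y : K} (hc : c ≠ 0) (ha : a₁ ≠ a₂)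
    (h₁ : (b₂ - a₁) * (y - 0) = (c - 0) * (x - a₁))
    (h₂ : (b₁ - a₂) * (y - 0) = (c - 0) * (x - a₂)) :
    a₁ - a₂ + (b₁ - b₂) ≠ 0 ∧
      x = (a₁ * (b₁ - b₂) + b₂ * (a₁ - a₂)) / (a₁ - a₂ + (b₁ - b₂)) ∧
      y = c * (a₁ - a₂) / (a₁ - a₂ + (b₁ - b₂)) := by
  have hy : y * (a₁ - a₂ + (b₁ - b₂)) = c * (a₁ - a₂) := by linear_combination h₂ - h₁
  have hN : a₁ - a₂ + (b₁ - b₂) ≠ 0 := by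
    intro h
    rw [h, mul_zero] at hy
    exact mul_ne_zero hc (sub_ne_zero.2 ha) hy.symm
  refine ⟨hN, ?_, by rw [eq_div_iff hN, hy]⟩
  rw [eq_div_iff hN]
  refine mul_left_cancel₀ hc ?_
  linear_combination -(a₁ - a₂ + (b₁ - b₂)) * h₁ + (b₂ - a₁) * hy

/-- On the lines `y = 0` and `y = c` the intersections have homogeneous coordinates `(aᵢbᵢ - aⱼbⱼ,
c(aᵢ - aⱼ), aᵢ - aⱼ + bᵢ - bⱼ)`, again additive in the pairs 12 and 23. -/
theorem pappus_parallel_axes {a₁ a₂ a₃ b₁ b₂ b₃ c x y x' y' x'' y'' : K} (hc : c ≠ 0)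
    (h12 : a₁ ≠ a₂) (h23 : a₂ ≠ a₃) (h13 : a₁ ≠ a₃)
    (hX : (b₂ - a₁) * (y - 0) = (c - 0) * (x - a₁))
    (hX' : (b₁ - a₂) * (y - 0) = (c - 0) * (x - a₂))
    (hY : (b₃ - a₂) * (y' - 0) = (c - 0) * (x' - a₂))
    (hY' : (b₂ - a₃) * (y' - 0) = (c - 0) * (x' - a₃))
    (hZ : (b₃ - a₁) * (y'' - 0) = (c - 0) * (x'' - a₁))
    (hZ' : (b₁ - a₃) * (y'' - 0) = (c - 0) * (x'' - a₃)) :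
    (x' - x) * (y'' - y) = (y' - y) * (x'' - x) := by
  obtain ⟨n1, rfl, rfl⟩ := intersection_of_parallel_axes hc h12 hX hX'
  obtain ⟨n2, rfl, rfl⟩ := intersection_of_parallel_axes hc h23 hY hY'
  obtain ⟨n3, rfl, rfl⟩ := intersection_of_parallel_axes hc h13 hZ hZ'
  field_simp
  ring

theorem pappus_parallel_axes_one_parallel {a₁ a₂ a₃ b₁ b₂ b₃ c x y x' y' : K} (hc : c ≠ 0)
    (h12 : a₁ ≠ a₂) (h23 : a₂ ≠ a₃)
    (hX : (b₂ - a₁) * (y - 0) = (c - 0) * (x - a₁))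
    (hX' : (b₁ - a₂) * (y - 0) = (c - 0) * (x - a₂))
    (hY : (b₃ - a₂) * (y' - 0) = (c - 0) * (x' - a₂))
    (hY' : (b₂ - a₃) * (y' - 0) = (c - 0) * (x' - a₃)) (hpar : b₃ - a₁ = b₁ - a₃) :
    (x' - x) * c = (y' - y) * (b₃ - a₁) := by
  obtain ⟨n1, rfl, rfl⟩ := intersection_of_parallel_axes hc h12 hX hX'
  obtain ⟨n2, rfl, rfl⟩ := intersection_of_parallel_axes hc h23 hY hY'
  -- Parallelism of the third pair makes its denominator vanish, so the other two denominators are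
  -- opposite.
  have hN : a₂ - a₃ + (b₂ - b₃) = -(a₁ - a₂ + (b₁ - b₂)) := by linear_combination -hpar
  rw [hN]
  have hb : b₁ = b₃ - a₁ + a₃ := by rw [hpar]; ring
  subst hb
  field_simp
  ring

end PappusAlgebra

/-! ### From lines to directions -/

namespace AffinePlane

variable {P : Type*} (π : AffinePlane P)

theorem line_unique {l m : Set P} (hl : l ∈ π.lines) (hm : m ∈ π.lines) {A B : P} (hAB : A ≠ B)
    (h1 : A ∈ l) (h2 : B ∈ l) (h3 : A ∈ m) (h4 : B ∈ m) : l = m :=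
  (π.line_through A B hAB).unique ⟨hl, h1, h2⟩ ⟨hm, h3, h4⟩

theorem Parallel.symm {l m : Set P} (h : Parallel l m) : Parallel m l :=
  h.imp Eq.symm fun h1 => h1.symm

theorem Parallel.eq_of_mem {l m : Set P} (h : Parallel l m) {A : P} (h1 : A ∈ l) (h2 : A ∈ m) :
    l = m :=
  h.resolve_right fun h3 => Set.disjoint_left.1 h3 h1 h2

theorem Parallel.trans {l m n : Set P} (hl : l ∈ π.lines) (hm : m ∈ π.lines) (hn : n ∈ π.lines)
    (h : Parallel l m) (h' : Parallel m n) : Parallel l n := by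
  by_contra hln
  obtain ⟨hne, hd⟩ := not_or.1 hln
  obtain ⟨A, h1, h2⟩ := Set.not_disjoint_iff.1 hd
  by_cases hA : A ∈ m
  · exact hne ((h.eq_of_mem h1 hA).trans (h'.eq_of_mem hA h2))
  · refine hne ((π.playfair A m hm hA).unique ⟨hl, h1, ?_⟩ ⟨hn, h2, ?_⟩)
    · exact (h.resolve_left (by rintro rfl; exact hA h1)).symm
    · exact h'.resolve_left (by rintro rfl; exact hA h2)

theorem exists_parallel {l : Set P} (hl : l ∈ π.lines) (A : P) :
    ∃ m ∈ π.lines, A ∈ m ∧ Parallel l m := by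
  by_cases hA : A ∈ l
  · exact ⟨l, hl, hA, Or.inl rfl⟩
  · obtain ⟨m, ⟨h1, h2, h3⟩, -⟩ := π.playfair A l hl hA
    exact ⟨m, h1, h2, Or.inr h3⟩

theorem exists_line (A B : P) : ∃ l, π.Join A B l := by
  by_cases hAB : A = B
  · subst hAB
    obtain ⟨C, hC⟩ : ∃ C, A ≠ C := by
      obtain ⟨X, Y, -, hXY, -⟩ := π.noncollinear
      by_contra! h
      exact hXY ((h X).symm.trans (h Y))
    obtain ⟨l, ⟨h1, h2, -⟩, -⟩ := π.line_through A C hC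
    exact ⟨l, h1, h2, h2⟩
  · exact (π.line_through A B hAB).exists

/-- Parallelism as an equivalence relation on the lines. -/
def parallelSetoid : Setoid π.lines where
  r l m := Parallel l.1 m.1
  iseqv := ⟨fun _ => Or.inl rfl, Parallel.symm,
    fun {l m n} h h' => Parallel.trans π l.2 m.2 n.2 h h'⟩

/-- The directions: the parallel classes of lines. -/
def Direction : Type _ := Quotient π.parallelSetoid

/-- The direction of a line. -/
def dir {l : Set P} (hl : l ∈ π.lines) : π.Direction := Quotient.mk π.parallelSetoid ⟨l, hl⟩

theorem dir_eq_iff {l m : Set P} (hl : l ∈ π.lines) (hm : m ∈ π.lines) :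
    π.dir hl = π.dir hm ↔ Parallel l m :=
  Quotient.eq (r := π.parallelSetoid)

/-- Two points lie on a common line of direction `d`. -/
def Aligned (d : π.Direction) (X Y : P) : Prop :=
  ∃ (l : Set P) (hl : l ∈ π.lines), π.dir hl = d ∧ X ∈ l ∧ Y ∈ l

variable {π}

theorem aligned_dir_iff {l : Set P} (hl : l ∈ π.lines) {X Y : P} (hX : X ∈ l) :
    π.Aligned (π.dir hl) X Y ↔ Y ∈ l := by
  constructor
  · rintro ⟨m, hm, hd, h1, h2⟩
    rw [π.dir_eq_iff] at hd
    rwa [hd.eq_of_mem h1 hX] at h2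
  · exact fun h => ⟨l, hl, rfl, hX, h⟩

theorem exists_line_of_dir (d : π.Direction) (X : P) :
    ∃ (l : Set P) (hl : l ∈ π.lines), π.dir hl = d ∧ X ∈ l := by
  obtain ⟨⟨l, hl⟩, rfl⟩ := Quotient.exists_rep d
  obtain ⟨m, hm, hX, h⟩ := π.exists_parallel hl X
  exact ⟨m, hm, (π.dir_eq_iff hm hl).2 h.symm, hX⟩

theorem aligned_refl (d : π.Direction) (X : P) : π.Aligned d X X := by
  obtain ⟨l, hl, hd, hX⟩ := exists_line_of_dir d X
  exact ⟨l, hl, hd, hX, hX⟩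

theorem Aligned.symm {d : π.Direction} {X Y : P} : π.Aligned d X Y → π.Aligned d Y X := by
  rintro ⟨l, hl, hd, h1, h2⟩
  exact ⟨l, hl, hd, h2, h1⟩

theorem Aligned.trans {d : π.Direction} {X Y Z : P} (h : π.Aligned d X Y)
    (h' : π.Aligned d Y Z) : π.Aligned d X Z := by
  obtain ⟨l, hl, rfl, h1, h2⟩ := h
  rw [aligned_dir_iff hl h2] at h'
  exact ⟨l, hl, rfl, h1, h'⟩

theorem aligned_eq_of_ne {d e : π.Direction} {X Y : P} (hde : d ≠ e) (h : π.Aligned d X Y)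
    (h' : π.Aligned e X Y) : X = Y := by
  obtain ⟨l, hl, rfl, h1, h2⟩ := h
  obtain ⟨m, hm, rfl, h3, h4⟩ := h'
  by_contra hXY
  obtain rfl := π.line_unique hl hm hXY h1 h2 h3 h4
  exact hde rfl

theorem aligned_meet {d e : π.Direction} (hde : d ≠ e) (X Y : P) :
    ∃ Z, π.Aligned d X Z ∧ π.Aligned e Y Z := by
  obtain ⟨l, hl, rfl, hX⟩ := exists_line_of_dir d X
  obtain ⟨m, hm, rfl, hY⟩ := exists_line_of_dir e Y
  have h1 : ¬ Parallel l m := fun h => hde ((π.dir_eq_iff hl hm).2 h)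
  obtain ⟨Z, h2, h3⟩ := Set.not_disjoint_iff.1 (not_or.1 h1).2
  exact ⟨Z, ⟨l, hl, rfl, hX, h2⟩, ⟨m, hm, rfl, hY, h3⟩⟩

/-- If some line has at least three points, then all lines have. -/
theorem isParallelism {l : Set P} (hl : l ∈ π.lines) {A₁ A₂ A₃ B : P} (h1 : A₁ ∈ l) (h2 : A₂ ∈ l)
    (h3 : A₃ ∈ l) (hB : B ∉ l) (h12 : A₁ ≠ A₂) (h23 : A₂ ≠ A₃) (h13 : A₁ ≠ A₃) :
    IsParallelism π.Aligned := by
  have hdir : ∀ {A : P}, A ∈ l → ∃ d, d ≠ π.dir hl ∧ π.Aligned d B A := by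
    intro A hA
    obtain ⟨m, hm, h4, h5⟩ := π.exists_line B A
    refine ⟨π.dir hm, fun h => ?_, (aligned_dir_iff hm h4).2 h5⟩
    rw [π.dir_eq_iff] at h
    exact hB (h.eq_of_mem h5 hA ▸ h4)
  have hne : ∀ {A A' : P} {d d'}, A ∈ l → A' ∈ l → A ≠ A' → d ≠ π.dir hl →
      π.Aligned d B A → π.Aligned d' B A' → d ≠ d' := by
    rintro A A' d _ hA hA' hAA' hd h4 h5 rfl
    exact hAA' (aligned_eq_of_ne hd (h4.symm.trans h5) ((aligned_dir_iff hl hA).2 hA'))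
  obtain ⟨c₁, n1, k1⟩ := hdir h1
  obtain ⟨c₂, n2, k2⟩ := hdir h2
  obtain ⟨c₃, n3, k3⟩ := hdir h3
  have m12 := hne h1 h2 h12 n1 k1 k2
  have m23 := hne h2 h3 h23 n2 k2 k3
  have m13 := hne h1 h3 h13 n1 k1 k3
  -- The direction of `l` and those joining `B` to `A₁, A₂, A₃` are four in number, so three remain
  -- besides any `d`. The lines in these through a point `W` off a line of direction `d` cut that
  -- line in three points.
  have three : ∀ d : π.Direction, ∃ c c' c'', c ≠ d ∧ c' ≠ d ∧ c'' ≠ d ∧ c ≠ c' ∧ c' ≠ c'' ∧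
      c ≠ c'' := by
    intro d
    by_cases e1 : c₁ = d
    · exact ⟨π.dir hl, c₂, c₃, by grind⟩
    by_cases e2 : c₂ = d
    · exact ⟨π.dir hl, c₁, c₃, by grind⟩
    by_cases e3 : c₃ = d
    · exact ⟨π.dir hl, c₁, c₂, by grind⟩
    exact ⟨c₁, c₂, c₃, by grind⟩
  refine ⟨aligned_refl, Aligned.symm, Aligned.trans, fun X Y => ?_, aligned_eq_of_ne,
    aligned_meet, fun d A C => ?_, fun d e => ?_⟩
  · obtain ⟨m, hm, h4, h5⟩ := π.exists_line X Y
    exact ⟨π.dir hm, m, hm, rfl, h4, h5⟩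
  · obtain ⟨W, hW⟩ : ∃ W, ¬ π.Aligned d A W := by
      by_contra! h
      have hd : d = π.dir hl := by
        by_contra hd
        exact h12 (aligned_eq_of_ne hd ((h A₁).symm.trans (h A₂)) ((aligned_dir_iff hl h1).2 h2))
      subst hd
      exact hB ((aligned_dir_iff hl h1).1 ((h A₁).symm.trans (h B)))
    obtain ⟨c, c', c'', n, n', n'', m, m', m''⟩ := three d
    obtain ⟨X, x1, x2⟩ := aligned_meet n.symm A W
    obtain ⟨Y, y1, y2⟩ := aligned_meet n'.symm A W
    obtain ⟨Z, z1, z2⟩ := aligned_meet n''.symm A W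
    have sep : ∀ {c c' X Y}, c ≠ c' → π.Aligned d A X → π.Aligned c W X → π.Aligned c' W Y →
        X ≠ Y := by
      rintro c c' X _ hcc' h4 h5 h6 rfl
      exact hW (aligned_eq_of_ne hcc' h5 h6 ▸ h4)
    have hXY := sep m x1 x2 y2
    have hYZ := sep m' y1 y2 z2
    have hXZ := sep m'' x1 x2 z2
    by_cases e1 : X ≠ A ∧ X ≠ C
    · exact ⟨X, x1, e1⟩
    by_cases e2 : Y ≠ A ∧ Y ≠ C
    · exact ⟨Y, y1, e2⟩
    exact ⟨Z, z1, by grind⟩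
  · obtain ⟨c, c', -, n, n', -, m, -⟩ := three d
    by_cases e1 : c = e
    · exact ⟨c', n', fun h => m (e1.trans h.symm)⟩
    · exact ⟨c, n, e1⟩

theorem ParallelDesargues.aligned (h : π.ParallelDesargues) : ParallelDesarguesDir π.Aligned := by
  intro d a b c A B C A' B' C' hA hB hC hAB hBC hAC ha ha' hb hb' hc
  obtain ⟨k, hk, hkd, k1, k2⟩ := hA
  obtain ⟨l, hl, hld, l1, l2⟩ := hB
  obtain ⟨m, hm, hmd, m1, m2⟩ := hC
  obtain ⟨ab, hab, habd, ab1, ab2⟩ := ha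
  obtain ⟨ab', hab', habd', ab1', ab2'⟩ := ha'
  obtain ⟨bc, hbc, hbcd, bc1, bc2⟩ := hb
  obtain ⟨bc', hbc', hbcd', bc1', bc2'⟩ := hb'
  obtain ⟨ac, hac, rfl, ac1, ac2⟩ := hc
  obtain ⟨ac', hac', ac1', ac2'⟩ := π.exists_line A' C'
  refine ⟨ac', hac', ?_, ac1', ac2'⟩
  rw [π.dir_eq_iff]
  refine Parallel.symm (h k l m hk hl hm ?_ ?_ ?_ ?_ ?_ ?_ A B C A' B' C' k1 k2 l1 l2 m1 m2 ab bc ac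
    ab' bc' ac' ⟨hab, ab1, ab2⟩ ⟨hbc, bc1, bc2⟩ ⟨hac, ac1, ac2⟩ ⟨hab', ab1', ab2'⟩
    ⟨hbc', bc1', bc2'⟩ ⟨hac', ac1', ac2'⟩ ?_ ?_)
  · rintro rfl; exact hAB ⟨k, hk, hkd, k1, l1⟩
  · rintro rfl; exact hBC ⟨l, hl, hld, l1, m1⟩
  · rintro rfl; exact hAC ⟨k, hk, hkd, k1, m1⟩
  all_goals exact (π.dir_eq_iff (by assumption) (by assumption)).1 (by simp only [*])

theorem ConcurrentDesargues.aligned (h : π.ConcurrentDesargues) :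
    ConcurrentDesarguesDir π.Aligned := by
  intro O k l m a b c A B C A' B' C' hAO hBO hCO hAO' hBO' hCO' hA hA' hB hB' hC hC' hkl hlm hkm
    ha ha' hb hb' hc
  obtain ⟨k, hk, rfl, k0, k1⟩ := hA
  obtain ⟨l, hl, rfl, l0, l1⟩ := hB
  obtain ⟨m, hm, rfl, m0, m1⟩ := hC
  rw [aligned_dir_iff _ k0] at hA'
  rw [aligned_dir_iff _ l0] at hB'
  rw [aligned_dir_iff _ m0] at hC'
  obtain ⟨ab, hab, habd, ab1, ab2⟩ := ha
  obtain ⟨ab', hab', habd', ab1', ab2'⟩ := ha'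
  obtain ⟨bc, hbc, hbcd, bc1, bc2⟩ := hb
  obtain ⟨bc', hbc', hbcd', bc1', bc2'⟩ := hb'
  obtain ⟨ac, hac, rfl, ac1, ac2⟩ := hc
  obtain ⟨ac', hac', ac1', ac2'⟩ := π.exists_line A' C'
  refine ⟨ac', hac', ?_, ac1', ac2'⟩
  rw [π.dir_eq_iff]
  refine Parallel.symm (h k l m hk hl hm ?_ ?_ ?_ O k0 l0 m0 A B C A' B' C' k1 hA' l1 hB' m1 hC'
    hAO hAO' hBO hBO' hCO hCO' ab bc ac
    ab' bc' ac' ⟨hab, ab1, ab2⟩ ⟨hbc, bc1, bc2⟩ ⟨hac, ac1, ac2⟩ ⟨hab', ab1', ab2'⟩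
    ⟨hbc', bc1', bc2'⟩ ⟨hac', ac1', ac2'⟩ ?_ ?_)
  · rintro rfl; exact hkl rfl
  · rintro rfl; exact hlm rfl
  · rintro rfl; exact hkm rfl
  all_goals exact (π.dir_eq_iff (by assumption) (by assumption)).1 (by simp only [*])

end AffinePlane

/-! ### Pappus' theorem in a finite Desarguesian plane -/

namespace AffinePlane

variable {P : Type*} {π : AffinePlane P}

theorem ne_of_mem_of_notMem {l : Set P} {A B : P} (hA : A ∈ l) (hB : B ∉ l) : A ≠ B := by
  rintro rfl; exact hB hA

theorem parallel_iff_aligned {l m : Set P} (hl : l ∈ π.lines) (hm : m ∈ π.lines) {A B C F : P}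
    (hAB : A ≠ B) (hA : A ∈ l) (hB : B ∈ l) (hCF : C ≠ F) (hC : C ∈ m) (hF : F ∈ m) :
    Parallel l m ↔ ∃ c, π.Aligned c A B ∧ π.Aligned c C F := by
  rw [← π.dir_eq_iff hl hm]
  constructor
  · intro h
    exact ⟨π.dir hl, (aligned_dir_iff hl hA).2 hB, by rw [h]; exact (aligned_dir_iff hm hC).2 hF⟩
  · rintro ⟨c, ⟨l', hl', rfl, h1, h2⟩, ⟨m', hm', h3, h4, h5⟩⟩
    obtain rfl := π.line_unique hl hl' hAB hA hB h1 h2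
    obtain rfl := π.line_unique hm hm' hCF hC hF h4 h5
    exact h3.symm

theorem mem_iff_aligned {l : Set P} (hl : l ∈ π.lines) {A B X : P} (hAB : A ≠ B) (hA : A ∈ l)
    (hB : B ∈ l) : X ∈ l ↔ ∃ c, π.Aligned c A B ∧ π.Aligned c A X := by
  constructor
  · exact fun h => ⟨π.dir hl, (aligned_dir_iff hl hA).2 hB, (aligned_dir_iff hl hA).2 h⟩
  · rintro ⟨c, ⟨m, hm, rfl, h1, h2⟩, h3⟩
    obtain rfl := π.line_unique hl hm hAB hA hB h1 h2
    exact (aligned_dir_iff hl hA).1 h3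

/-- The theorem of Pappus in terms of coordinates. -/
theorem pappus_of_det {K : Type*} [Field K] {x y : P → K}
    (hdet : ∀ A B C F, (∃ c, π.Aligned c A B ∧ π.Aligned c C F) ↔
        (x B - x A) * (y F - y C) = (y B - y A) * (x F - x C))
    {l m : Set P} {a₁ a₂ a₃ b₁ b₂ b₃ : P} {c₁₂ c₂₁ c₂₃ c₃₂ c₁₃ c₃₁ : Set P}
    (H : π.IsPappusHexagon l m a₁ a₂ a₃ b₁ b₂ b₃ c₁₂ c₂₁ c₂₃ c₃₂ c₁₃ c₃₁)
    (h0 : ∀ X Y Z, X ∈ c₁₂ ∩ c₂₁ → Y ∈ c₂₃ ∩ c₃₂ → Z ∈ c₁₃ ∩ c₃₁ →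
      (x Y - x X) * (y Z - y X) = (y Y - y X) * (x Z - x X))
    (h1 : ∀ X Y, X ∈ c₁₂ ∩ c₂₁ → Y ∈ c₂₃ ∩ c₃₂ →
      (x b₃ - x a₁) * (y b₁ - y a₃) = (y b₃ - y a₁) * (x b₁ - x a₃) →
      (x Y - x X) * (y b₃ - y a₁) = (y Y - y X) * (x b₃ - x a₁))
    (h2 : (x b₂ - x a₁) * (y b₁ - y a₂) = (y b₂ - y a₁) * (x b₁ - x a₂) →
      (x b₃ - x a₂) * (y b₂ - y a₃) = (y b₃ - y a₂) * (x b₂ - x a₃) →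
      (x b₃ - x a₁) * (y b₁ - y a₃) = (y b₃ - y a₁) * (x b₁ - x a₃)) :
    (∀ X Y Z : P, X ∈ c₁₂ ∩ c₂₁ → Y ∈ c₂₃ ∩ c₃₂ → Z ∈ c₁₃ ∩ c₃₁ →
      ∃ n ∈ π.lines, X ∈ n ∧ Y ∈ n ∧ Z ∈ n) ∧
    (∀ X Y : P, X ∈ c₁₂ ∩ c₂₁ → Y ∈ c₂₃ ∩ c₃₂ → Parallel c₁₃ c₃₁ →
      ∃ n ∈ π.lines, X ∈ n ∧ Y ∈ n ∧ Parallel n c₁₃) ∧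
    (Parallel c₁₂ c₂₁ → Parallel c₂₃ c₃₂ → Parallel c₁₃ c₃₁) := by
  obtain ⟨-, -, ⟨ha1, ha2, ha3⟩, -, -, ⟨hb1, hb2, hb3⟩, -, -, j12, j21, j23, j32, j13, j31⟩ := H
  have hne : ∀ {A B}, A ∈ l → B ∉ l → A ≠ B := fun h h' => ne_of_mem_of_notMem h h'
  have par : ∀ {a b a' b' c c'}, a ∈ l → b ∉ l → a' ∈ l → b' ∉ l → π.Join a b c → π.Join a' b' c' →
      (Parallel c c' ↔ (x b - x a) * (y b' - y a') = (y b - y a) * (x b' - x a')) := by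
    intro a b a' b' c c' ha hb ha' hb' hc hc'
    rw [parallel_iff_aligned hc.1 hc'.1 (hne ha hb) hc.2.1 hc.2.2 (hne ha' hb') hc'.2.1 hc'.2.2, hdet]
  refine ⟨fun X Y Z hX hY hZ => ?_, fun X Y hX hY hp => ?_, fun hp hp' => ?_⟩
  · by_cases hXY : X = Y
    · obtain ⟨n, hn, n1, n2⟩ := π.exists_line X Z
      exact ⟨n, hn, n1, hXY ▸ n1, n2⟩
    · obtain ⟨n, hn, n1, n2⟩ := π.exists_line X Y
      exact ⟨n, hn, n1, n2, (mem_iff_aligned hn hXY n1 n2).2 ((hdet _ _ _ _).2 (h0 X Y Z hX hY hZ))⟩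
  · by_cases hXY : X = Y
    · obtain ⟨n, hn, n1, n2⟩ := π.exists_parallel j13.1 X
      exact ⟨n, hn, n1, hXY ▸ n1, n2.symm⟩
    · obtain ⟨n, hn, n1, n2⟩ := π.exists_line X Y
      refine ⟨n, hn, n1, n2, (parallel_iff_aligned hn j13.1 hXY n1 n2 (hne ha1 hb3) j13.2.1
        j13.2.2).2 ((hdet _ _ _ _).2 (h1 X Y hX hY ?_))⟩
      exact (par ha1 hb3 ha3 hb1 j13 j31).1 hp
  · rw [par ha1 hb3 ha3 hb1 j13 j31]
    exact h2 ((par ha1 hb2 ha2 hb1 j12 j21).1 hp) ((par ha2 hb3 ha3 hb2 j23 j32).1 hp')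

/-- Hessenberg's and Wedderburn's theorems combined: a finite Desarguesian plane is Pappian. -/
theorem IsDesarguesian.isPappian [Finite P] (h : π.IsDesarguesian) : π.IsPappian := by
  intro l m a₁ a₂ a₃ b₁ b₂ b₃ c₁₂ c₂₁ c₂₃ c₃₂ c₁₃ c₃₁ H
  have H' := H
  obtain ⟨hl, hm, ⟨ha1, ha2, ha3⟩, ⟨hb1, hb2, hb3⟩, ⟨ha1', ha2', ha3'⟩, ⟨hb1', hb2', hb3'⟩,
    ⟨ha12, ha23, ha13⟩, -, j12, j21, j23, j32, j13, j31⟩ := H'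
  have hE := isParallelism hl ha1 ha2 ha3 hb1' ha12 ha23 ha13
  have hp := ParallelDesargues.aligned h.1
  have hc := ConcurrentDesargues.aligned h.2
  by_cases hlm : Parallel l m
  -- With `l` as first axis and any transversal as second, `l` is `y = 0` and the parallel `m` is `y
  -- = y b₁`.
  · obtain ⟨e, hed, -⟩ := hE.exists_dir_ne_ne (π.dir hl) (π.dir hl)
    obtain ⟨K, _, x, y, hx, hy, hinj, hdet⟩ := hE.exists_coordinates hp hc a₁ hed.symm
    have on : ∀ {a b c X}, a ∈ l → b ∉ l → π.Join a b c → X ∈ c →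
        (x b - x a) * (y X - y a) = (y b - y a) * (x X - x a) := by
      intro a b c X ha hb hc hX
      exact (hdet _ _ _ _).1
        ((mem_iff_aligned hc.1 (ne_of_mem_of_notMem ha hb) hc.2.1 hc.2.2).1 hX)
    have hya : ∀ {a}, a ∈ l → y a = 0 := fun ha => (hy _).2 ((aligned_dir_iff hl ha1).2 ha)
    have hxa : ∀ {a a'}, a ∈ l → a' ∈ l → a ≠ a' → x a ≠ x a' := fun ha ha' hne h1 =>
      hne (hinj _ _ h1 ((hya ha).trans (hya ha').symm))
    have hyb : ∀ {b}, b ∈ m → y b = y b₁ := by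
      intro b hb
      have h1 := (hdet a₁ a₂ b₁ b).1 ⟨π.dir hl, (aligned_dir_iff hl ha1).2 ha2, by
        rw [(π.dir_eq_iff hl hm).2 hlm]; exact (aligned_dir_iff hm hb1).2 hb⟩
      rw [hya ha1, hya ha2, sub_self, zero_mul] at h1
      exact sub_eq_zero.1
        ((mul_eq_zero.1 h1).resolve_left (sub_ne_zero.2 (hxa ha2 ha1 ha12.symm)))
    have hb0 : y b₁ ≠ 0 := fun h1 => hb1' ((aligned_dir_iff hl ha1).1 ((hy _).1 h1))
    have e2 := hyb hb2
    have e3 := hyb hb3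
    have on' : ∀ {a b c X}, a ∈ l → b ∈ m → b ∉ l → π.Join a b c → X ∈ c →
        (x b - x a) * (y X - 0) = (y b₁ - 0) * (x X - x a) := by
      intro a b c X ha hb hbl hc hX
      have h1 := on ha hbl hc hX
      rwa [hya ha, hyb hb] at h1
    refine pappus_of_det hdet H (fun X Y Z hX hY hZ => ?_) (fun X Y hX hY hpar => ?_) ?_
    · exact pappus_parallel_axes hb0 (hxa ha1 ha2 ha12) (hxa ha2 ha3 ha23) (hxa ha1 ha3 ha13)
        (on' ha1 hb2 hb2' j12 hX.1) (on' ha2 hb1 hb1' j21 hX.2) (on' ha2 hb3 hb3' j23 hY.1)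
        (on' ha3 hb2 hb2' j32 hY.2) (on' ha1 hb3 hb3' j13 hZ.1) (on' ha3 hb1 hb1' j31 hZ.2)
    · rw [e3, hya ha1, hya ha3] at hpar
      rw [e3, hya ha1, sub_zero]
      refine pappus_parallel_axes_one_parallel hb0 (hxa ha1 ha2 ha12) (hxa ha2 ha3 ha23)
        (on' ha1 hb2 hb2' j12 hX.1) (on' ha2 hb1 hb1' j21 hX.2) (on' ha2 hb3 hb3' j23 hY.1)
        (on' ha3 hb2 hb2' j32 hY.2) ?_
      refine mul_left_cancel₀ hb0 ?_
      linear_combination hpar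
    · rw [e2, e3, hya ha1, hya ha2, hya ha3]
      intro h1 h2
      linear_combination h1 + h2
  · obtain ⟨O, hOl, hOm⟩ := Set.not_disjoint_iff.1 (not_or.1 hlm).2
    have hde : π.dir hl ≠ π.dir hm := fun h1 => hlm ((π.dir_eq_iff hl hm).1 h1)
    -- The axes are `l` and `m` themselves, with origin at their intersection.
    obtain ⟨K, _, x, y, hx, hy, hinj, hdet⟩ := hE.exists_coordinates hp hc O hde
    have hya : ∀ {a}, a ∈ l → y a = 0 := fun ha => (hy _).2 ((aligned_dir_iff hl hOl).2 ha)
    have hxb : ∀ {b}, b ∈ m → x b = 0 := fun hb => (hx _).2 ((aligned_dir_iff hm hOm).2 hb)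
    have hxa0 : ∀ {a}, a ∉ m → x a ≠ 0 := fun ha h1 =>
      ha ((aligned_dir_iff hm hOm).1 ((hx _).1 h1))
    have hyb0 : ∀ {b}, b ∉ l → y b ≠ 0 := fun hb h1 =>
      hb ((aligned_dir_iff hl hOl).1 ((hy _).1 h1))
    have hxa : ∀ {a a'}, a ∈ l → a' ∈ l → a ≠ a' → (x a)⁻¹ - (x a')⁻¹ ≠ 0 := fun ha ha' hne =>
      inv_sub_inv_ne fun h1 => hne (hinj _ _ h1 ((hya ha).trans (hya ha').symm))
    have on : ∀ {a b c X}, a ∈ l → a ∉ m → b ∈ m → b ∉ l → π.Join a b c → X ∈ c →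
        (x a)⁻¹ * x X + (y b)⁻¹ * y X = 1 := by
      intro a b c X ha ham hb hbl hc hX
      have h1 := (hdet _ _ _ _).1
        ((mem_iff_aligned hc.1 (ne_of_mem_of_notMem ha hbl) hc.2.1 hc.2.2).1 hX)
      rw [hya ha, hxb hb] at h1
      exact line_eq_of_intercepts (hxa0 ham) (hyb0 hbl) h1
    have n1 := hxa0 ha1'
    have n2 := hxa0 ha2'
    have n3 := hxa0 ha3'
    have k1 := hyb0 hb1'
    have k2 := hyb0 hb2'
    have k3 := hyb0 hb3'
    refine pappus_of_det hdet H (fun X Y Z hX hY hZ => ?_) (fun X Y hX hY hpar => ?_) ?_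
    · exact pappus_axes (hxa ha1 ha2 ha12) (hxa ha2 ha3 ha23) (hxa ha1 ha3 ha13)
        (on ha1 ha1' hb2 hb2' j12 hX.1) (on ha2 ha2' hb1 hb1' j21 hX.2)
        (on ha2 ha2' hb3 hb3' j23 hY.1) (on ha3 ha3' hb2 hb2' j32 hY.2)
        (on ha1 ha1' hb3 hb3' j13 hZ.1) (on ha3 ha3' hb1 hb1' j31 hZ.2)
    · rw [hya ha1, hya ha3, hxb hb1, hxb hb3] at hpar
      have h1 := pappus_axes_one_parallel (hxa ha1 ha2 ha12) (hxa ha2 ha3 ha23)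
        (on ha1 ha1' hb2 hb2' j12 hX.1) (on ha2 ha2' hb1 hb1' j21 hX.2)
        (on ha2 ha2' hb3 hb3' j23 hY.1) (on ha3 ha3' hb2 hb2' j32 hY.2)
        (by field_simp; linear_combination hpar)
      rw [hya ha1, hxb hb3]
      field_simp at h1
      linear_combination h1
    -- The sides of pair `i, j` are parallel exactly when `x aᵢ * y bᵢ = x aⱼ * y bⱼ`, a transitive
    -- relation.
    · rw [hya ha1, hya ha2, hya ha3, hxb hb1, hxb hb2, hxb hb3]
      intro h1 h2
      linear_combination h1 + h2

end AffinePlane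

/-! ### Extreme points of finite ordered lines -/

section Betweenness

variable {P : Type*} {btw : P → P → P → Prop} {l : Set P}

/-- `B` cuts the line into two sides, and `D` cannot be on the same side as both `A` and `C`. The
instances of the axioms listed below exclude that case. -/
theorem AffinePlane.IsOrderedLine.between_or (h : AffinePlane.IsOrderedLine btw l) {A B C D : P}
    (hA : A ∈ l) (hB : B ∈ l) (hC : C ∈ l) (hD : D ∈ l) (hAB : A ≠ B) (hAC : A ≠ C) (hAD : A ≠ D)
    (hBC : B ≠ C) (hBD : B ≠ D) (hCD : C ≠ D) (hb : btw A B C) : btw A B D ∨ btw C B D := by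
  have x1 := h.exactly_one A hA B hB C hC hAB hBC hAC
  have x2 := h.exactly_one A hA B hB D hD hAB hBD hAD
  have x3 := h.exactly_one C hC B hB D hD hBC.symm hBD hCD
  have y1 := h.symm A hA B hB C hC hAB hBC hAC hb
  have y2 := h.symm B hB D hD A hA hBD hAD.symm hAB.symm
  have y3 := h.symm B hB D hD C hC hBD hCD.symm hBC
  have y4 := h.symm D hD B hB C hC hBD.symm hBC hCD.symm
  have y5 := h.symm C hC A hA B hB hAC.symm hAB hBC.symm
  have y6 := h.symm A hA C hC B hB hAC hBC.symm hAB
  have y7 := h.symm D hD B hB A hA hBD.symm hAB.symm hAD.symm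
  have o1 := h.outer D hD A hA B hB C hC hAD.symm hBD.symm hCD.symm hAB hAC hBC
  have o2 := h.outer C hC A hA D hD B hB hAC.symm hCD hBC.symm hAD hAB hBD.symm
  have o3 := h.outer A hA C hC D hD B hB hAC hAD hAB hCD hBC.symm hBD.symm
  have o4 := h.outer D hD C hC B hB A hA hCD.symm hBD.symm hAD.symm hBC.symm hAC.symm hAB.symm
  have s1 := h.same_side A hA D hD B hB C hC hAD hAB hAC hBD.symm hCD.symm hBC
  grind

/-- Transitivity of betweenness: a point between `B` and `C` is between `A` and `C` if `B` is. -/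
theorem AffinePlane.IsOrderedLine.between_trans (h : AffinePlane.IsOrderedLine btw l) {A B X C : P}
    (hA : A ∈ l) (hB : B ∈ l) (hX : X ∈ l) (hC : C ∈ l) (hAB : A ≠ B) (hAX : A ≠ X) (hAC : A ≠ C)
    (hBX : B ≠ X) (hBC : B ≠ C) (hXC : X ≠ C) (hb : btw A B C) (hb' : btw B X C) :
    btw A X C := by
  rcases h.between_or hA hB hC hX hAB hAC hAX hBC hBX hXC.symm hb with h1 | h1
  · exact (h.outer A hA B hB X hX C hC hAB hAX hAC hBX hBC hXC h1 hb').2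
  · have := h.exactly_one B hB X hX C hC hBX hXC hBC
    tauto

/-- On a finite ordered line there is a point that is not between any two others. -/
theorem AffinePlane.IsOrderedLine.exists_extreme [Finite P] (h : AffinePlane.IsOrderedLine btw l)
    {A₀ B₀ : P} (hA₀ : A₀ ∈ l) (hB₀ : B₀ ∈ l) (hAB₀ : A₀ ≠ B₀) :
    ∃ A ∈ l, ∀ D ∈ l, ∀ F ∈ l, D ≠ A → A ≠ F → D ≠ F → ¬ btw D A F := by
  -- The extreme point is an end of an open interval with the most points: if `A` were between `D`
  -- and `C`, the interval from `D` to `C` would contain that from `A` to `C` and also `A`.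
  let S : P × P → Set P := fun p => {X | X ∈ l ∧ p.1 ≠ X ∧ X ≠ p.2 ∧ btw p.1 X p.2}
  obtain ⟨⟨A, C⟩, ⟨hA, hC, hAC⟩, hmax⟩ := Set.exists_max_image
    {p : P × P | p.1 ∈ l ∧ p.2 ∈ l ∧ p.1 ≠ p.2} (fun p => (S p).ncard) (Set.toFinite _)
    ⟨(A₀, B₀), hA₀, hB₀, hAB₀⟩
  simp only at hA hC hAC
  have key : ∀ D ∈ l, D ≠ A → D ≠ C → ¬ btw D A C := by
    intro D hD hDA hDC hb
    refine absurd (hmax (D, C) ⟨hD, hC, hDC⟩) (not_le.2 (Set.ncard_lt_ncard ?_ (Set.toFinite _)))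
    refine ⟨fun X => ?_, fun hsub => ?_⟩
    · rintro ⟨hX, hAX, hXC, hbX⟩
      have hDX : D ≠ X := by
        rintro rfl
        have h1 := h.exactly_one D hX A hA C hC hDA hAC hDC
        have h2 := h.symm A hA D hX C hC hAX hDC hAC hbX
        tauto
      exact ⟨hX, hDX, hXC, h.between_trans hD hA hX hC hDA hDX hDC hAX hAC hXC hb hbX⟩
    · exact (hsub (show A ∈ S (D, C) from ⟨hA, hDA, hAC, hb⟩)).2.1 rfl
  refine ⟨A, hA, fun D hD F hF hDA hAF hDF hb => ?_⟩
  have hb' := h.symm D hD A hA F hF hDA hAF hDF hb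
  by_cases hDC : D = C
  · subst hDC
    exact key F hF hAF.symm hDF.symm hb'
  by_cases hFC : F = C
  · subst hFC
    exact key D hD hDA hDF hb
  -- If `A` separates `D` from `F`, it separates one of them from `C`, against `key`.
  rcases h.between_or hD hA hF hC hDA hDF hDC hAF hAC hFC hb with h1 | h1
  · exact key D hD hDA hDC h1
  · exact key F hF hAF.symm hFC h1

end Betweenness

/-! ### Finite ordered planes have no three collinear points -/

namespace AffinePlane

variable {P : Type*} {π : AffinePlane P}

theorem exists_projectsTo {d l : Set P} (hd : d ∈ π.lines) (hl : l ∈ π.lines)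
    (hdl : ¬ Parallel d l) (X : P) : ∃ X', π.ProjectsTo d l X X' := by
  obtain ⟨e, he, hX, hde⟩ := π.exists_parallel hd X
  have h1 : ¬ Parallel e l := fun h => hdl (hde.trans π hd he hl h)
  obtain ⟨X', h2, h3⟩ := Set.not_disjoint_iff.1 (not_or.1 h1).2
  exact ⟨X', h3, e, ⟨he, hX, h2⟩, hde⟩

theorem ProjectsTo.inj {d l l' : Set P} (hd : d ∈ π.lines) (hl : l ∈ π.lines)
    (hdl : ¬ Parallel d l) {X Y Z : P} (hX : X ∈ l) (hY : Y ∈ l) (h1 : π.ProjectsTo d l' X Z)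
    (h2 : π.ProjectsTo d l' Y Z) : X = Y := by
  obtain ⟨-, e, ⟨he, e1, e2⟩, hde⟩ := h1
  obtain ⟨-, f, ⟨hf, f1, f2⟩, hdf⟩ := h2
  obtain rfl := (hde.symm.trans π he hd hf hdf).eq_of_mem e2 f2
  by_contra hXY
  obtain rfl := π.line_unique hl he hXY hX hY e1 f1
  exact hdl hde

/-- On the lines of a finite ordered plane there are at most two points: two parallel projections,
onto a second line and back, map any point to an extreme one. -/
theorem IsOrderedBy.not_three [Finite P] {btw : P → P → P → Prop} (h : π.IsOrderedBy btw)
    {l : Set P} (hl : l ∈ π.lines) {A B C Z : P} (hA : A ∈ l) (hB : B ∈ l) (hC : C ∈ l)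
    (hZ : Z ∉ l) (hAB : A ≠ B) (hBC : B ≠ C) (hAC : A ≠ C) : False := by
  have ho := h.ordered_line l hl
  obtain ⟨X, hX, hext⟩ := ho.exists_extreme hA hB hAB
  obtain ⟨D, Y, F, hD, hY, hF, hDY, hYF, hDF, hb⟩ : ∃ D Y F, D ∈ l ∧ Y ∈ l ∧ F ∈ l ∧ D ≠ Y ∧
      Y ≠ F ∧ D ≠ F ∧ btw D Y F := by
    rcases ho.exactly_one A hA B hB C hC hAB hBC hAC with h1 | h1 | h1
    · exact ⟨A, B, C, hA, hB, hC, hAB, hBC, hAC, h1.1⟩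
    · exact ⟨B, C, A, hB, hC, hA, hBC, hAC.symm, hAB.symm, h1.2.1⟩
    · exact ⟨C, A, B, hC, hA, hB, hAC.symm, hAB, hBC.symm, h1.2.2⟩
  -- Projecting `l` onto its parallel `m` along `YZ`, and back along `ZX`, sends the inner point `Y`
  -- via `Z` to the extreme point `X`.
  obtain ⟨m, hm, hZm, hlm⟩ := π.exists_parallel hl Z
  obtain ⟨d, hd, hYd, hZd⟩ := π.exists_line Y Z
  obtain ⟨e, he, hZe, hXe⟩ := π.exists_line Z X
  have hnl : ∀ {c W}, W ∈ l → W ∈ c → Z ∈ c → ¬ Parallel c l := fun hW hWc hZc hp =>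
    hZ (hp.eq_of_mem hWc hW ▸ hZc)
  have hnm : ∀ {c W}, c ∈ π.lines → W ∈ l → W ∈ c → Z ∈ c → ¬ Parallel c m := fun hc hW hWc hZc hp =>
    hnl hW hWc hZc (hp.trans π hc hm hl hlm.symm)
  have hdl := hnl hY hYd hZd
  have hdm := hnm hd hY hYd hZd
  have hel := hnl hX hXe hZe
  have hem := hnm he hX hXe hZe
  have hYZ : π.ProjectsTo d m Y Z := ⟨hZm, d, ⟨hd, hYd, hZd⟩, Or.inl rfl⟩
  have hZX : π.ProjectsTo e l Z X := ⟨hX, e, ⟨he, hZe, hXe⟩, Or.inl rfl⟩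
  obtain ⟨D', hD'⟩ := exists_projectsTo hd hm hdm D
  obtain ⟨F', hF'⟩ := exists_projectsTo hd hm hdm F
  obtain ⟨D'', hD''⟩ := exists_projectsTo he hl hel D'
  obtain ⟨F'', hF''⟩ := exists_projectsTo he hl hel F'
  -- Betweenness is meaningful only for distinct points; injectivity of the projections keeps the
  -- images distinct.
  have n1 : D' ≠ Z := by rintro rfl; exact hDY (hD'.inj hd hl hdl hD hY hYZ)
  have n2 : Z ≠ F' := by rintro rfl; exact hYF (hYZ.inj hd hl hdl hY hF hF')
  have n3 : D' ≠ F' := by rintro rfl; exact hDF (hD'.inj hd hl hdl hD hF hF')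
  have k1 : D'' ≠ X := by rintro rfl; exact n1 (hD''.inj he hm hem hD'.1 hZm hZX)
  have k2 : X ≠ F'' := by rintro rfl; exact n2 (hZX.inj he hm hem hZm hF'.1 hF'')
  have k3 : D'' ≠ F'' := by rintro rfl; exact n3 (hD''.inj he hm hem hD'.1 hF'.1 hF'')
  have hb' := h.projection l m d hl hm hd hdl hdm D Y F D' Z F' hD hY hF hDY hYF hDF hD' hYZ hF' hb
  exact hext D'' hD''.1 F'' hF''.1 k1 k2 k3 (h.projection m l e hm hl he hem hel D' Z F' D'' X F''
    hD'.1 hZm hF'.1 n1 n2 n3 hD'' hZX hF'' hb')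

end AffinePlane

/-- Every finite Desarguesian affine plane is Pappian; and every finite ordered affine plane
in which at least the parallel form of the axiom of Desargues holds is Pappian. -/
theorem mainTheorem3 {P : Type*} [Finite P] (π : AffinePlane P) :
    (π.IsDesarguesian → π.IsPappian) ∧
    (π.ParallelDesargues → ∀ btw : P → P → P → Prop, π.IsOrderedBy btw → π.IsPappian) := by
  refine ⟨fun h => h.isPappian, fun _ btw h => ?_⟩
  intro l m a₁ a₂ a₃ b₁ b₂ b₃ c₁₂ c₂₁ c₂₃ c₃₂ c₁₃ c₃₁ H
  exact (h.not_three H.line_l H.a_on.1 H.a_on.2.1 H.a_on.2.2 H.b_off.1 H.a_distinct.1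
    H.a_distinct.2.1 H.a_distinct.2.2).elim
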